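/- Let $\omega=e^{2\pi i/3}$. On the cell-centred Kreweras lattice (the directed graph on $1+(\omega-1)\mathbb{Z}[\omega]\subset\mathbb{C}$ with an edge from $v$ to $v+(\omega-1)\omega^{j}$ for every vertex $v$ and $j=0,1,2$), the origin $0$ is the centre of the triangular cell $1\to\omega\to\omega^2\to1$, whose corners are the vertices closest to $0$. Let $$E(t,s)=\sum_{w}t^{|w|}s^{k(w)},$$ where $w$ ranges over the finite directed walks which start at $1$ and end at one of $1,\omega,\omega^2$; here $|w|$ is the number of steps of $w$ and $\frac{2\pi k(w)}{3}$, with $k(w)\in\mathbb{Z}$, is its winding angle, i.e. the total (signed) anticlockwise angle by which the vector from $0$ to a point moving continuously along $w$ turns. On the vertex-centred Kreweras lattice (the directed graph on $\mathbb{Z}[\omega]$ with an edge from $v$ to $v+\omega^{j}$ for every vertex $v$ and $j=0,1,2$), let $\tilde E(t,s)$ be defined by the same sum, where $w$ now ranges over the finite directed walks which never visit $0$, start at $-1$ and end at one of $-1,-\omega,-\omega^2$ (the three vertices from which there is an edge to $0$). If $s\in\mathbb{C}$ is a root of unity with $s^3\neq1$, then the formal power series $E(t,s)$ and $\tilde E(t,s)$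 in $\mathbb{C}[[t]]$ are algebraic in $t$, i.e. each is algebraic over $\mathbb{C}(t)$: it is a root of a nonzero polynomial with coefficients in $\mathbb{C}[t]$. -/

import Mathlib

open scoped PowerSeries

/-- The primitive cube root of unity `exp (2 π i / 3)`. -/
noncomputable def zeta3 : ℂ := Complex.exp (2 * Real.pi * Complex.I / 3)

/-- A walk of length `n`, recorded by its steps: at each vertex of the Kreweras lattice there are
exactly three outgoing edges, with directions differing by rotations through `2 π / 3`. -/
abbrev KWalk (n : ℕ) : Type := Fin n → Fin 3

/-- The vertex reached after the first `i` steps of the walk `w` which starts at `p` and whose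
steps are the vectors `a`, `a * zeta3`, `a * zeta3 ^ 2`. -/
noncomputable def KWalk.vertex (p a : ℂ) {n : ℕ} (w : KWalk n) (i : ℕ) : ℂ :=
  p + ∑ j ∈ Finset.univ.filter (fun j : Fin n => (j : ℕ) < i), a * zeta3 ^ (w j : ℕ)

/-- The winding angle around `0`: the sum over the edges of the signed angle in `(-π, π]` swept
by the vector from `0` to the moving point (along a segment which avoids `0` this
angle is the principal argument of the quotient of the endpoints). -/
noncomputable def KWalk.windingAngle (p a : ℂ) {n : ℕ} (w : KWalk n) : ℝ :=
  ∑ i ∈ Finset.range n, Complex.arg (w.vertex p a (i + 1) / w.vertex p a i)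

/-- The walks of length `n` from `p`, with steps `a * zeta3 ^ j`, which avoid `0`, end in the
set `T` and have winding angle `2 π k / 3`. -/
def krewerasWalks (p a : ℂ) (T : Set ℂ) (n : ℕ) (k : ℤ) : Set (KWalk n) :=
  {w | (∀ i ≤ n, w.vertex p a i ≠ 0) ∧ w.vertex p a n ∈ T ∧
    w.windingAngle p a = 2 * Real.pi * k / 3}

/-- The generating function, as a formal power series in `t`, in which every walk of length `n`
from `p` to `T` with winding angle `2 π k / 3` contributes `t ^ n * s ^ k`
(for each `n` only finitely many `k` contribute). -/
noncomputable def krewerasSeries (p a : ℂ) (T : Set ℂ) (s : ℂ) : ℂ⟦X⟧ :=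
  PowerSeries.mk fun n => ∑ᶠ k : ℤ, ((krewerasWalks p a T n k).ncard : ℂ) * s ^ k

/-- `E(t,s)`. Cell-centred Kreweras lattice: the origin is the centre of the triangular cell with
vertices `1, zeta3, zeta3 ^ 2`, which the directed edges `1 → zeta3 → zeta3 ^ 2 → 1` run around
anticlockwise. Walks start at `1` and end at one of the vertices closest to the origin. -/
noncomputable def cellSeries (s : ℂ) : ℂ⟦X⟧ :=
  krewerasSeries 1 (zeta3 - 1) {1, zeta3, zeta3 ^ 2} s

/-- `Ẽ(t,s)`. Vertex-centred Kreweras lattice: vertices `ℤ[zeta3]`, edges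
`v → v + zeta3 ^ j`. Walks avoid `0`, start at `-1` and end at one of the vertices
`-1, -zeta3, -zeta3 ^ 2` from which an edge points to `0`. -/
noncomputable def vertexSeries (s : ℂ) : ℂ⟦X⟧ :=
  krewerasSeries (-1) 1 {-1, -zeta3, -zeta3 ^ 2} s

/-- For each `n` the sum over `k` which defines the coefficient of `t ^ n` is finite. -/
theorem krewerasSeries_finite (p a : ℂ) (T : Set ℂ) (s : ℂ) (n : ℕ) :
    (Function.support fun k : ℤ => ((krewerasWalks p a T n k).ncard : ℂ) * s ^ k).Finite := by
  refine Set.Finite.subset (Set.finite_iUnion (ι := KWalk n)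
    (f := fun w => {k : ℤ | w.windingAngle p a = 2 * Real.pi * k / 3}) fun w => ?_) ?_
  · refine Set.Subsingleton.finite fun k hk l hl => ?_
    have h : 2 * Real.pi * (k : ℝ) / 3 = 2 * Real.pi * (l : ℝ) / 3 := hk.symm.trans hl
    have hpi := Real.pi_ne_zero
    field_simp at h
    exact_mod_cast h
  · intro k hk
    by_contra hne
    apply hk
    have : krewerasWalks p a T n k = ∅ := by
      rw [Set.eq_empty_iff_forall_notMem]
      intro w hw
      exact hne (Set.mem_iUnion.2 ⟨w, hw.2.2⟩)
    simp [this]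

/-!
The plane is cut into three congruent sectors which the rotation through `2 π / 3` permutes. A walk
is recorded by its position inside a sector, and every crossing into the next or the previous sector
contributes a factor `s` or `s⁻¹`, so that the power of `s` measures the winding angle. The
generating function then satisfies a functional equation with the Kreweras kernel
(`kernel_equation`), whose unknowns are the series `A` and `B` of the walks that start on the two
sides of the sector.

The kernel vanishes on the curve `x + y + z = 1 / t`, `x * y * z = 1`, which is symmetric in the
three coordinates. There the functional equation says that a function `f(x; z)`, with coefficients
built from `A(x)` and `B(x)`, is multiplied by a power of `s` and a monomial when `(x; z)` is
replaced by `(y; x)`. So, up to monomials, the conjugate functions `u = f(x; z)` and `v = f(x; y)`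
have `n`-th powers which are invariant as soon as `s ^ n = 1`. A function of `x` that takes the same
value at `y` is a polynomial in `I = x * y + y * z + z * x` (`exists_eq_eval_curveInv`). Applied to
`u ^ n + v ^ n` and to `(x - y) * (y - z) * (z - x) * (u ^ n - v ^ n)` this gives polynomials `P`
and `Q` in `I`. Because `u * v` is, up to a constant, a power of a linear polynomial `I - r`, and
the square of `(x - y) * (y - z) * (z - x)` is a squarefree cubic `Δ` in `I`, they lead to a Pell
equation `P ^ 2 - Δ * W ^ 2 = const * (I - r) ^ (2 * h)`, where `Q = Δ * W`.

Such an equation is rigid: by a comparison of degrees in its derivative, every derivation of the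
field of fractions of `ℂ⟦t⟧` which kills `t` kills `r` and the coefficients of `P`, unless `W = 0`
(`derivation_eq_zero_of_pell`). Hence it kills `u + v` (`proportional_or_derivation_eq_zero`), from
which the series of the walks between the central points can be read off at `x = 0`. The exceptional
case, where `u` and `v` are proportional, is impossible for the cell-centred lattice, and for the
vertex-centred one it determines `u * v` through its zeros on the branch curve `y = z`
(`derivation_eq_zero_of_discriminant`). A power series killed by all derivations that kill `t` is
algebraic (`isAlgebraic_of_derivation`), because a transcendental one would be an independent
variable with respect to which one could differentiate.
-/

/-! ### A Pell equation over a differential field -/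

section Pell

open Polynomial Differential

/-- In `P ^ 2 - D * W ^ 2` the two terms have degrees of different parity and cannot cancel. -/
lemma natDegree_of_pell {L : Type*} [Field L] {D P W : L[X]} {c r : L} {h : ℕ}
    (hD : D.natDegree = 3) (hW : W ≠ 0) (hc : c ≠ 0)
    (hP : P ^ 2 - D * W ^ 2 = C c * (X - C r) ^ (2 * h)) :
    P.natDegree = h ∧ 2 * W.natDegree + 3 < 2 * h := by
  have hD0 : D ≠ 0 := by rintro rfl; simp at hD
  have h1 : (D * W ^ 2).natDegree = 2 * W.natDegree + 3 := by
    rw [natDegree_mul hD0 (pow_ne_zero _ hW), natDegree_pow, hD, add_comm]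
  have h2 : (P ^ 2).natDegree = 2 * P.natDegree := natDegree_pow _ _
  have h3 : (C c * (X - C r) ^ (2 * h)).natDegree = 2 * h := by
    rw [natDegree_C_mul hc, natDegree_pow, natDegree_X_sub_C, mul_one]
  rw [← hP] at h3
  rcases lt_or_ge (P ^ 2).natDegree (D * W ^ 2).natDegree with hlt | hge
  · rw [natDegree_sub_eq_right_of_natDegree_lt hlt] at h3
    omega
  · have hlt : (D * W ^ 2).natDegree < (P ^ 2).natDegree := by omega
    rw [natDegree_sub_eq_left_of_natDegree_lt hlt] at h3
    omega

variable {L : Type*} [Field L] [Differential L]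

lemma natDegree_mapCoeffs_le (P : L[X]) : (mapCoeffs P).natDegree ≤ P.natDegree := by
  refine natDegree_le_iff_coeff_eq_zero.2 fun N hN => ?_
  rw [coeff_mapCoeffs, coeff_eq_zero_of_natDegree_lt hN, map_zero]

/-- The primitive case: if `X - r` is not a common factor of `P` and `W`, the Wronskian of `P` and
`W` is divisible by a power of `X - r` above its degree, so it vanishes. -/
lemma deriv_eq_zero_of_pell_primitive [CharZero L] {D P W : L[X]} {c r : L} {h : ℕ}
    (hD : D.natDegree = 3) (hsq : Squarefree D) (hDd : mapCoeffs D = 0) (hW : W ≠ 0)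
    (hc : c ≠ 0) (hcd : c′ = 0)
    (hP : P ^ 2 - D * W ^ 2 = C c * (X - C r) ^ (2 * h))
    (hprim : ¬ (X - C r ∣ P ∧ X - C r ∣ W)) :
    r′ = 0 ∧ mapCoeffs P = 0 ∧ mapCoeffs W = 0 := by
  obtain ⟨hPd, hWd⟩ := natDegree_of_pell hD hW hc hP
  obtain ⟨k, rfl⟩ : ∃ k, h = k + 1 := ⟨h - 1, by omega⟩
  set e : L[X] := X - C r with he
  have hep : Prime e := prime_X_sub_C r
  have hPe : ¬ e ∣ P := by
    intro hdvd
    have h1 : e ^ 2 ∣ D * W ^ 2 := by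
      have : D * W ^ 2 = P ^ 2 - C c * e ^ (2 * (k + 1)) := by rw [← hP]; ring
      rw [this]
      exact dvd_sub (pow_dvd_pow_of_dvd hdvd 2)
        (Dvd.dvd.mul_left (pow_dvd_pow e (by omega)) _)
    have hWe : ¬ e ∣ W := fun hw => hprim ⟨hdvd, hw⟩
    have h2 : e ^ 2 ∣ D :=
      hep.pow_dvd_of_dvd_mul_right 2 (fun hw => hWe (hep.dvd_of_dvd_pow hw)) h1
    exact hep.not_isUnit (hsq e (by rwa [← sq]))
  have hWe : ¬ e ∣ W := by
    intro hw
    apply hPe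
    apply hep.dvd_of_dvd_pow (n := 2)
    have : P ^ 2 = D * W ^ 2 + C c * e ^ (2 * (k + 1)) := by rw [← hP]; ring
    rw [this]
    exact dvd_add (Dvd.dvd.mul_left (dvd_pow hw two_ne_zero) _)
      (Dvd.dvd.mul_left (dvd_pow_self e (by omega)) _)
  have hde : mapCoeffs e = - C r′ := by simp [he]
  -- differentiate the equation
  have hdiff : P * mapCoeffs P - D * (W * mapCoeffs W)
      = - C (((k : L) + 1) * c * r′) * e ^ (2 * k + 1) := by
    have := congrArg (mapCoeffs (A := L)) hP
    simp only [map_sub, Derivation.leibniz, Derivation.leibniz_pow, hDd, hde, mapCoeffs_C, hcd,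
      smul_eq_mul, nsmul_eq_mul] at this
    have h2 : (2 : L[X]) ≠ 0 := two_ne_zero
    apply mul_left_cancel₀ h2
    have e1 : 2 * (k + 1) - 1 = 2 * k + 1 := by omega
    rw [e1] at this
    simp only [map_mul, map_add, map_one, map_natCast]
    push_cast at this
    simp only [map_zero, mul_zero, add_zero] at this
    linear_combination this
  have hlc : (P.leadingCoeff)′ = 0 := by
    have h1 : P.leadingCoeff ^ 2 = c := by
      have h2 : (C c * e ^ (2 * (k + 1))).leadingCoeff = c := by
        rw [leadingCoeff_mul, leadingCoeff_C, leadingCoeff_pow, leadingCoeff_X_sub_C, one_pow,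
          mul_one]
      rw [← leadingCoeff_pow, ← h2, ← hP, leadingCoeff_sub_of_degree_lt]
      apply degree_lt_degree
      rw [natDegree_pow, natDegree_mul (by rintro rfl; simp at hD) (pow_ne_zero _ hW), hD,
        natDegree_pow]
      omega
    have h2 := congrArg (fun x : L => x′) h1
    simp only [Derivation.leibniz_pow, hcd, smul_eq_mul, nsmul_eq_mul] at h2
    have h3 : P.leadingCoeff ≠ 0 := by
      intro h0; rw [h0] at h1; exact hc (by rw [← h1]; simp)
    simpa [h3] using h2
  have hdP : (mapCoeffs P).natDegree ≤ k := by
    refine natDegree_le_iff_coeff_eq_zero.2 fun N hN => ?_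
    rw [coeff_mapCoeffs]
    rcases Nat.lt_or_ge (k + 1) N with h' | h'
    · rw [coeff_eq_zero_of_natDegree_lt (by omega), map_zero]
    · have : N = P.natDegree := by omega
      rw [this]; exact hlc
  have hV : mapCoeffs W * P - mapCoeffs P * W = 0 := by
    by_contra hne
    have hdvd : e ^ (2 * k + 1) ∣ mapCoeffs W * P - mapCoeffs P * W := by
      refine hep.pow_dvd_of_dvd_mul_left (2 * k + 1) hPe ?_
      refine ⟨C c * e * mapCoeffs W + W * C (((k : L) + 1) * c * r′), ?_⟩
      linear_combination (mapCoeffs W) * hP - W * hdiff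
    have h1 := natDegree_le_of_dvd hdvd hne
    rw [natDegree_pow, natDegree_X_sub_C, mul_one] at h1
    have h2 : (mapCoeffs W * P - mapCoeffs P * W).natDegree ≤ 2 * k := by
      refine (natDegree_sub_le _ _).trans (max_le ?_ ?_)
      · refine natDegree_mul_le.trans ?_
        have := natDegree_mapCoeffs_le W
        omega
      · refine natDegree_mul_le.trans ?_
        omega
    omega
  have hkey : e * mapCoeffs W = - C (((k : L) + 1) * r′) * W := by
    have h1 : C c * e ^ (2 * k + 1) * (e * mapCoeffs W)
        = C c * e ^ (2 * k + 1) * (- C (((k : L) + 1) * r′) * W) := by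
      have : C (((k : L) + 1) * c * r′) = C c * C (((k : L) + 1) * r′) := by
        rw [← C_mul]; congr 1; ring
      rw [this] at hdiff
      linear_combination P * hV - (mapCoeffs W) * hP + W * hdiff
    exact mul_left_cancel₀ (mul_ne_zero (C_ne_zero.2 hc) (pow_ne_zero _ hep.ne_zero)) h1
  have hr : r′ = 0 := by
    by_contra hr
    apply hWe
    have hk : ((k : L) + 1) ≠ 0 := by exact_mod_cast Nat.succ_ne_zero k
    have hu : IsUnit (- C (((k : L) + 1) * r′)) :=
      (isUnit_C.2 (isUnit_iff_ne_zero.2 (mul_ne_zero hk hr))).neg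
    exact (hu.dvd_mul_left).1 ⟨_, hkey.symm⟩
  have hdW : mapCoeffs W = 0 := by
    rw [hr] at hkey
    simpa [hep.ne_zero] using hkey
  refine ⟨hr, ?_, hdW⟩
  rw [hdW] at hV
  simpa [hW] using hV

/-- Let `D` be squarefree of degree three with constant coefficients, and let
`P ^ 2 - D * W ^ 2 = c * (X - r) ^ (2 * h)` with `c` constant. Either `W = 0`, or `r` and all
coefficients of `P` and `W` are constant. Geometrically `P + W * √D` is a function on an elliptic
curve over the field of constants with a single zero and a single pole, so the zero is a torsion
point and cannot move. -/
theorem deriv_eq_zero_of_pell [CharZero L] {D : L[X]} {c r : L}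
    (hD : D.natDegree = 3) (hsq : Squarefree D) (hDd : mapCoeffs D = 0)
    (hc : c ≠ 0) (hcd : c′ = 0) (h : ℕ) :
    ∀ P W : L[X], P ^ 2 - D * W ^ 2 = C c * (X - C r) ^ (2 * h) →
      W = 0 ∨ (r′ = 0 ∧ mapCoeffs P = 0 ∧ mapCoeffs W = 0) := by
  induction h with
  | zero =>
    intro P W hP
    by_contra! hcon
    have := (natDegree_of_pell hD hcon.1 hc hP).2
    omega
  | succ h ih =>
    intro P W hP
    by_cases hW : W = 0
    · exact Or.inl hW
    by_cases hprim : X - C r ∣ P ∧ X - C r ∣ W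
    · obtain ⟨⟨P₁, rfl⟩, ⟨W₁, rfl⟩⟩ := hprim
      have he : (X - C r : L[X]) ≠ 0 := X_sub_C_ne_zero r
      have h1 : P₁ ^ 2 - D * W₁ ^ 2 = C c * (X - C r) ^ (2 * h) := by
        apply mul_left_cancel₀ (pow_ne_zero 2 he)
        linear_combination hP
      rcases ih P₁ W₁ h1 with h0 | ⟨hr, hp, hw⟩
      · exact absurd (by rw [h0, mul_zero]) hW
      · right
        refine ⟨hr, ?_, ?_⟩ <;> simp [Derivation.leibniz, hp, hw, hr]
    · exact Or.inr (deriv_eq_zero_of_pell_primitive hD hsq hDd hW hc hcd hP hprim)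

/-- `deriv_eq_zero_of_pell` for a derivation that is linear over a subfield. -/
theorem derivation_eq_zero_of_pell {k L : Type*} [Field k] [Field L] [Algebra k L] [CharZero L]
    (δ : Derivation k L L) {D P W : L[X]} {c r : L} {h : ℕ} (hD : D.natDegree = 3)
    (hsq : Squarefree D) (hDd : ∀ i, δ (D.coeff i) = 0) (hc : c ≠ 0) (hcd : δ c = 0)
    (hP : P ^ 2 - D * W ^ 2 = C c * (X - C r) ^ (2 * h)) :
    W = 0 ∨ (δ r = 0 ∧ ∀ i, δ (P.coeff i) = 0) := by
  let _ : Differential L :=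
    ⟨Derivation.mk' (δ : L →ₗ[k] L).toAddMonoidHom.toIntLinearMap fun a b => δ.leibniz a b⟩
  have hDd' : mapCoeffs D = 0 := by
    ext i
    exact hDd i
  rcases deriv_eq_zero_of_pell hD hsq hDd' hc hcd h P W hP with h0 | ⟨hr, hPd, -⟩
  · exact Or.inl h0
  · refine Or.inr ⟨hr, fun i => ?_⟩
    have := congrArg (fun p => p.coeff i) hPd
    rwa [coeff_mapCoeffs, coeff_zero] at this

end Pell

/-! ### Derivations of fields of characteristic zero -/

section ExistsDerivation

open TensorProduct

/-- A derivation extends along a formally étale algebra. -/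
lemma Derivation.exists_extend_of_formallyEtale (R S T : Type*) [CommRing R] [CommRing S]
    [CommRing T] [Algebra R S] [Algebra R T] [Algebra S T] [IsScalarTower R S T]
    [Algebra.FormallyEtale S T] (d : Derivation R S T) :
    ∃ d' : Derivation R T T, ∀ a : S, d' (algebraMap S T a) = d a := by
  let φ : Ω[T⁄R] →ₗ[T] T := (LinearMap.liftBaseChange T d.liftKaehlerDifferential) ∘ₗ
    (KaehlerDifferential.tensorKaehlerEquivOfFormallyEtale R S T).symm.toLinearMap
  refine ⟨φ.compDer (KaehlerDifferential.D R T), fun a => ?_⟩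
  have := KaehlerDifferential.tensorKaehlerEquivOfFormallyEtale_symm_D_algebraMap R S T a
  simp [φ, this]

/-- Over a field of characteristic zero, a transcendental element is moved by some derivation:
extend it to a transcendence basis, take the partial derivative, and extend that derivation along
the separable extension generated by the rest. -/
theorem Transcendental.exists_derivation_eq_one {k L : Type*} [Field k] [Field L] [Algebra k L]
    [CharZero k] {a : L} (ha : Transcendental k a) : ∃ d : Derivation k L L, d a = 1 := by
  classical
  have h1 : AlgebraicIndepOn k id ({a} : Set L) := by
    have : AlgebraicIndependent k (fun x : ({a} : Set L) => (x : L)) := by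
      rw [algebraicIndependent_unique_type_iff]
      exact ha
    exact this
  obtain ⟨s, hs, hb⟩ := exists_isTranscendenceBasis_superset h1
  have has : a ∈ s := hs rfl
  let x : s → L := fun i => (i : L)
  have hx : IsTranscendenceBasis k x := hb
  let S := MvPolynomial s k
  let : Algebra S L := (MvPolynomial.aeval x).toAlgebra
  have hmap : ∀ p : S, algebraMap S L p = MvPolynomial.aeval x p := fun p => rfl
  have : IsScalarTower k S L := IsScalarTower.of_algebraMap_eq fun c =>
    (MvPolynomial.aeval_C x c).symm
  have hinj : Function.Injective (algebraMap S L) := hx.1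
  have : FaithfulSMul S L := (faithfulSMul_iff_algebraMap_injective S L).2 hinj
  let K := FractionRing S
  let : Algebra K L := FractionRing.liftAlgebra S L
  have : IsScalarTower S K L := FractionRing.isScalarTower_liftAlgebra S L
  have halg : Algebra.IsAlgebraic S L := by
    have h := hx.isAlgebraic
    refine ⟨fun y => (h.1 y).of_ringHom_of_comp_eq
      ((MvPolynomial.aeval x : S →ₐ[k] L).codRestrict (Algebra.adjoin k (Set.range x)) fun p => by
        rw [Algebra.adjoin_range_eq_range_aeval]; exact ⟨p, rfl⟩).toRingHom (RingHom.id L) ?_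
      Function.injective_id rfl⟩
    rintro ⟨z, hz⟩
    obtain ⟨p, hp⟩ := (Algebra.adjoin_range_eq_range_aeval k x).le hz
    exact ⟨p, Subtype.ext hp⟩
  have : Algebra.IsAlgebraic K L := by
    refine ⟨fun y => ?_⟩
    exact (IsFractionRing.isAlgebraic_iff S K L).1 (halg.1 y)
  have : CharZero S := charZero_of_injective_algebraMap (algebraMap k S).injective
  have : CharZero K := charZero_of_injective_algebraMap (IsFractionRing.injective S K)
  have : Algebra.FormallyEtale K L := Algebra.FormallyEtale.of_isSeparable K L
  have : Algebra.FormallyEtale S K := Algebra.FormallyEtale.of_isLocalization (nonZeroDivisors S)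
  have : Algebra.FormallyEtale S L := Algebra.FormallyEtale.comp S K L
  obtain ⟨d, hd⟩ := Derivation.exists_extend_of_formallyEtale k S L
    (MvPolynomial.mkDerivation k (fun i : s => if (i : L) = a then (1 : L) else 0))
  refine ⟨d, ?_⟩
  have := hd (MvPolynomial.X ⟨a, has⟩)
  rw [hmap, MvPolynomial.aeval_X, MvPolynomial.mkDerivation_X] at this
  simpa [x] using this

end ExistsDerivation

/-! ### Substituting a power series without constant term -/

section EvalSeries

open PowerSeries

variable {S : Type*} [CommRing S]

lemma coeff_mul_pow_eq_zero {τ : S⟦X⟧} (hτ : constantCoeff τ = 0) (f : S⟦X⟧) {m n : ℕ}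
    (h : m < n) : coeff m (f * τ ^ n) = 0 := by
  have h1 : (X : S⟦X⟧) ^ n ∣ f * τ ^ n :=
    Dvd.dvd.mul_left (pow_dvd_pow_of_dvd (X_dvd_iff.2 hτ) n) _
  exact X_pow_dvd_iff.1 h1 m h

lemma eval_trunc (τ : S⟦X⟧) (F : S⟦X⟧⟦X⟧) (N : ℕ) :
    (trunc N F).eval τ = ∑ n ∈ Finset.range N, coeff n F * τ ^ n := by
  simpa using eval₂_trunc_eq_sum_range τ (RingHom.id _) N F

lemma coeff_eval_trunc {τ : S⟦X⟧} (hτ : constantCoeff τ = 0) (F : S⟦X⟧⟦X⟧) {m M : ℕ}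
    (h : m < M) : coeff m ((trunc M F).eval τ) = coeff m ((trunc (m + 1) F).eval τ) := by
  rw [eval_trunc, eval_trunc, map_sum, map_sum]
  symm
  refine Finset.sum_subset (Finset.range_subset_range.2 h) fun n _ hn => ?_
  exact coeff_mul_pow_eq_zero hτ _ (by simpa using hn)

/-- The substitution `∑ n, F n * t ^ n ↦ ∑ n, F n * τ ^ n`, where the coefficients `F n` are
themselves power series and `τ` has no constant term. -/
noncomputable def evalSeries (τ : S⟦X⟧) (hτ : constantCoeff τ = 0) : S⟦X⟧⟦X⟧ →+* S⟦X⟧ where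
  toFun F := mk fun m => coeff m ((trunc (m + 1) F).eval τ)
  map_one' := by
    ext m
    rw [coeff_mk, trunc_one, Polynomial.eval_one]
  map_zero' := by
    ext m
    simp
  map_add' F G := by
    ext m
    simp
  map_mul' F G := by
    ext m
    rw [coeff_mk, coeff_mul]
    have h1 : ∀ p ∈ Finset.HasAntidiagonal.antidiagonal m,
        coeff p.1 (mk fun m => coeff m ((trunc (m + 1) F).eval τ)) *
        coeff p.2 (mk fun m => coeff m ((trunc (m + 1) G).eval τ))
        = coeff p.1 ((trunc (m + 1) F).eval τ) * coeff p.2 ((trunc (m + 1) G).eval τ) := by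
      rintro ⟨i, j⟩ hp
      have hij := Finset.HasAntidiagonal.mem_antidiagonal.1 hp
      dsimp only at hij ⊢
      rw [coeff_mk, coeff_mk, coeff_eval_trunc hτ F (show i < m + 1 by omega),
        coeff_eval_trunc hτ G (show j < m + 1 by omega)]
    rw [Finset.sum_congr rfl h1, ← coeff_mul,
      ← Polynomial.eval_mul, ← trunc_trunc_mul_trunc]
    set P := trunc (m + 1) F * trunc (m + 1) G with hP
    have h2 := trunc_coe_eq_self (f := P) (n := P.natDegree + m + 2) (by omega)
    rw [← Polynomial.coe_mul, ← coeff_eval_trunc hτ _ (show m < P.natDegree + m + 2 by omega), h2]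

variable {τ : S⟦X⟧} (hτ : constantCoeff τ = 0)

lemma coeff_evalSeries (F : S⟦X⟧⟦X⟧) {m M : ℕ} (h : m < M) :
    coeff m (evalSeries τ hτ F) = coeff m (∑ n ∈ Finset.range M, coeff n F * τ ^ n) := by
  change coeff m (mk fun m => coeff m ((trunc (m + 1) F).eval τ)) = _
  rw [coeff_mk, ← coeff_eval_trunc hτ F h, eval_trunc]

lemma constantCoeff_evalSeries (F : S⟦X⟧⟦X⟧) :
    constantCoeff (evalSeries τ hτ F) = constantCoeff (constantCoeff F) := by
  rw [← coeff_zero_eq_constantCoeff_apply, coeff_evalSeries hτ F (show 0 < 1 by omega)]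
  simp

lemma evalSeries_C (a : S⟦X⟧) : evalSeries τ hτ (C a) = a := by
  ext m
  rw [coeff_evalSeries hτ _ (Nat.lt_succ_self m), Finset.sum_range_succ']
  simp [coeff_C]

lemma evalSeries_X : evalSeries τ hτ X = τ := by
  ext m
  rw [coeff_evalSeries hτ _ (show m < m + 2 by omega), Finset.sum_range_succ',
    Finset.sum_range_succ']
  simp [coeff_X]

end EvalSeries

/-! ### Substitution into series with polynomial coefficients -/

section SubstSeries

open PowerSeries

/-- The substitution `x ↦ a`, `t ↦ τ` into a power series in `t` whose coefficients are
polynomials in `x`. Only `τ` needs to have no constant term. -/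
noncomputable def substSeries {S : Type*} [CommRing S] [Algebra ℂ S] (a τ : S⟦X⟧)
    (hτ : constantCoeff τ = 0) : (Polynomial ℂ)⟦X⟧ →+* S⟦X⟧ :=
  (evalSeries τ hτ).comp (PowerSeries.map (Polynomial.aeval a : Polynomial ℂ →ₐ[ℂ] S⟦X⟧))

variable {S : Type*} [CommRing S] [Algebra ℂ S] {a τ : S⟦X⟧} (hτ : constantCoeff τ = 0)

lemma substSeries_X : substSeries a τ hτ X = τ := by
  simp [substSeries, evalSeries_X]

lemma substSeries_C (p : Polynomial ℂ) :
    substSeries a τ hτ (C p) = Polynomial.aeval a p := by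
  simp [substSeries, evalSeries_C]

lemma substSeries_map_C (b : S⟦X⟧) (q : ℂ⟦X⟧) :
    substSeries a τ hτ (PowerSeries.map Polynomial.C q)
      = substSeries b τ hτ (PowerSeries.map Polynomial.C q) := by
  rw [substSeries, substSeries, RingHom.comp_apply, RingHom.comp_apply]
  congr 1
  ext n : 1
  simp

lemma constantCoeff_substSeries (F : (Polynomial ℂ)⟦X⟧) :
    constantCoeff (substSeries a τ hτ F)
      = Polynomial.aeval (constantCoeff a) (constantCoeff F) := by
  rw [substSeries, RingHom.comp_apply, constantCoeff_evalSeries,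
    ← coeff_zero_eq_constantCoeff_apply (PowerSeries.map _ _), coeff_map,
    coeff_zero_eq_constantCoeff_apply]
  simp only [RingHom.coe_coe]
  rw [Polynomial.aeval_def, Polynomial.aeval_def, Polynomial.hom_eval₂]
  rfl

/-- A homomorphism to a domain that does not kill the variable is injective as soon as the kernel
consists of series without constant term. -/
lemma injective_of_constantCoeff {R D : Type*} [CommRing R] [CommRing D] [IsDomain D]
    (φ : R⟦X⟧ →+* D) (hX : φ X ≠ 0) (h : ∀ F, φ F = 0 → constantCoeff F = 0) :
    Function.Injective φ := by
  rw [injective_iff_map_eq_zero]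
  intro F hF
  by_contra hne
  obtain ⟨F₀, hF₀⟩ := X_pow_order_dvd (φ := F)
  have hc : constantCoeff F₀ ≠ 0 := by
    have h1 := coeff_order hne
    generalize F.order.toNat = v at h1 hF₀
    have h2 := coeff_X_pow_mul F₀ v 0
    rw [zero_add, ← hF₀, coeff_zero_eq_constantCoeff_apply] at h2
    rwa [← h2]
  apply hc
  apply h
  rw [hF₀, map_mul, map_pow] at hF
  exact (mul_eq_zero.1 hF).resolve_left (pow_ne_zero _ hX)

end SubstSeries

/-! ### Exchanging the two variables -/

section Swap

open PowerSeries

/-- A power series in `t` with polynomial coefficients in `x`, regarded as a power series in `x`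
whose coefficients are power series in `t`. -/
noncomputable def swapSeries : (Polynomial ℂ)⟦X⟧ →+* ℂ⟦X⟧⟦X⟧ where
  toFun F := mk fun i => mk fun n => (coeff n F).coeff i
  map_one' := by
    ext i n
    simp only [coeff_mk, coeff_one]
    by_cases hn : n = 0 <;> by_cases hi : i = 0 <;> simp [hn, hi, Polynomial.coeff_one, coeff_one]
  map_zero' := by ext i n; simp
  map_add' F G := by ext i n; simp
  map_mul' F G := by
    ext i n
    simp only [coeff_mk, coeff_mul, Polynomial.finsetSum_coeff, Polynomial.coeff_mul, map_sum]
    rw [Finset.sum_comm]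

@[simp]
lemma coeff_coeff_swapSeries (F : (Polynomial ℂ)⟦X⟧) (i n : ℕ) :
    coeff n (coeff i (swapSeries F)) = (coeff n F).coeff i := by
  simp [swapSeries]

lemma swapSeries_injective : Function.Injective swapSeries := by
  intro F G h
  ext n i
  rw [← coeff_coeff_swapSeries, h, coeff_coeff_swapSeries]

@[simp]
lemma swapSeries_map_C (q : ℂ⟦X⟧) :
    swapSeries (PowerSeries.map Polynomial.C q) = C q := by
  ext i n
  simp only [coeff_coeff_swapSeries, coeff_map, coeff_C, Polynomial.coeff_C]
  split_ifs <;> simp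

@[simp]
lemma swapSeries_X : swapSeries X = C X := by
  ext i n
  simp only [coeff_coeff_swapSeries, coeff_X, coeff_C]
  by_cases hn : n = 1 <;> by_cases hi : i = 0 <;> simp [hn, hi, Polynomial.coeff_one, coeff_X]

@[simp]
lemma swapSeries_C_X : swapSeries (C Polynomial.X) = X := by
  ext i n
  simp only [coeff_coeff_swapSeries, coeff_X, coeff_C]
  by_cases hn : n = 0 <;> by_cases hi : i = 1 <;>
    simp [hn, hi, Polynomial.coeff_X, coeff_one, eq_comm]

/-- The value at `x = 0`. -/
noncomputable def atZero : (Polynomial ℂ)⟦X⟧ →+* ℂ⟦X⟧ := constantCoeff.comp swapSeries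

lemma coeff_atZero (F : (Polynomial ℂ)⟦X⟧) (n : ℕ) :
    coeff n (atZero F) = (coeff n F).coeff 0 := by
  rw [atZero, RingHom.comp_apply, ← coeff_zero_eq_constantCoeff_apply, coeff_coeff_swapSeries]

@[simp] lemma atZero_X : atZero X = X := by simp [atZero]

@[simp] lemma atZero_C_X : atZero (C Polynomial.X) = 0 := by simp [atZero]

@[simp] lemma atZero_map_C (q : ℂ⟦X⟧) : atZero (PowerSeries.map Polynomial.C q) = q := by
  simp [atZero]

@[simp] lemma atZero_C_C (c : ℂ) : atZero (C (Polynomial.C c)) = C c := by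
  rw [← map_C, atZero_map_C]

/-- A series which vanishes at `x = 0` is divisible by `x`. -/
lemma exists_eq_mul_of_atZero {F : (Polynomial ℂ)⟦X⟧} (h : atZero F = 0) :
    ∃ G, F = C Polynomial.X * G := by
  refine ⟨mk fun n => (coeff n F).divX, ?_⟩
  ext n : 1
  rw [coeff_C_mul, coeff_mk]
  have h1 : (coeff n F).coeff 0 = 0 := by rw [← coeff_atZero, h, map_zero]
  conv_lhs => rw [← Polynomial.X_mul_divX_add (coeff n F), h1]
  simp

end Swap

/-! ### Invariants on the kernel curve -/

section Kernel

open PowerSeries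

/-- Power series in one variable with polynomial coefficients in another one. The variables are
`x` (in the coefficients) and `t`, or, for functions on the kernel curve, `x` and `y`. -/
abbrev XSeries : Type := (Polynomial ℂ)⟦X⟧

/-- The variable of the coefficients. -/
noncomputable def xVar : XSeries := C Polynomial.X

/-- Series in `t` alone. -/
noncomputable def tSeries : ℂ⟦X⟧ →+* XSeries := PowerSeries.map Polynomial.C

lemma tSeries_injective : Function.Injective tSeries :=
  PowerSeries.map_injective _ Polynomial.C_injective

@[simp] lemma tSeries_X : tSeries X = X := by simp [tSeries]

@[simp] lemma atZero_xVar : atZero xVar = 0 := atZero_C_X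

@[simp] lemma atZero_tSeries (q : ℂ⟦X⟧) : atZero (tSeries q) = q := atZero_map_C q

lemma xVar_ne_zero : xVar ≠ 0 := by
  rw [xVar, Ne, map_eq_zero_iff _ C_injective]
  exact Polynomial.X_ne_zero

/-- The kernel curve `x * y = t * (1 + x ^ 2 * y + x * y ^ 2)` is parametrised by `(x, y)`: this is
`t` as a power series in `y`. -/
noncomputable def kernelT : XSeries :=
  xVar * X * invOfUnit (1 + xVar ^ 2 * X + xVar * X ^ 2) 1

lemma kernelT_mul : kernelT * (1 + xVar ^ 2 * X + xVar * X ^ 2) = xVar * X := by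
  rw [kernelT, mul_assoc, invOfUnit_mul _ 1 (by simp), mul_one]

lemma constantCoeff_kernelT : constantCoeff kernelT = 0 := by simp [kernelT]

lemma kernelT_ne_zero : kernelT ≠ 0 := by
  intro h
  have h1 := kernelT_mul
  rw [h, zero_mul] at h1
  exact mul_ne_zero xVar_ne_zero X_ne_zero h1.symm

/-- The series `F(x; t)` as a function on the kernel curve. -/
noncomputable def evalAtX : XSeries →+* XSeries := substSeries xVar kernelT constantCoeff_kernelT

/-- The series `F(y; t)` as a function on the kernel curve. -/
noncomputable def evalAtY : XSeries →+* XSeries := substSeries X kernelT constantCoeff_kernelT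

@[simp] lemma evalAtX_X : evalAtX X = kernelT := substSeries_X _

@[simp] lemma evalAtY_X : evalAtY X = kernelT := substSeries_X _

@[simp] lemma evalAtX_xVar : evalAtX xVar = xVar := by
  rw [evalAtX, xVar, substSeries_C, Polynomial.aeval_X]

@[simp] lemma evalAtY_xVar : evalAtY xVar = X := by
  rw [evalAtY, xVar, substSeries_C, Polynomial.aeval_X]

lemma evalAtX_tSeries (q : ℂ⟦X⟧) : evalAtX (tSeries q) = evalAtY (tSeries q) :=
  substSeries_map_C _ _ _

lemma constantCoeff_evalAtX (F : XSeries) : constantCoeff (evalAtX F) = constantCoeff F := by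
  rw [evalAtX, constantCoeff_substSeries, xVar, constantCoeff_C, Polynomial.aeval_X_left_apply]

lemma constantCoeff_evalAtY (F : XSeries) :
    constantCoeff (evalAtY F) = Polynomial.C ((constantCoeff F).coeff 0) := by
  rw [evalAtY, constantCoeff_substSeries, constantCoeff_X, Polynomial.aeval_def,
    Polynomial.eval₂_at_zero]
  rfl

lemma evalAtX_injective : Function.Injective evalAtX := by
  refine injective_of_constantCoeff _ (by simpa using kernelT_ne_zero) fun F hF => ?_
  rw [← constantCoeff_evalAtX, hF, map_zero]

lemma evalAtY_injective : Function.Injective evalAtY := by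
  refine injective_of_constantCoeff _ (by simpa using kernelT_ne_zero) fun F hF => ?_
  -- restrict to `x = 0`, where `t` vanishes and `y` is free
  have h1 : ((PowerSeries.map (Polynomial.evalRingHom (0 : ℂ))).comp evalAtY) F
      = ((constantCoeff F : Polynomial ℂ) : ℂ⟦X⟧) := by
    have key : PowerSeries.map (Polynomial.evalRingHom (0 : ℂ)) kernelT = 0 := by
      simp [kernelT, xVar]
    ext n
    rw [RingHom.comp_apply, coeff_map, evalAtY, substSeries, RingHom.comp_apply,
      coeff_evalSeries _ _ (Nat.lt_succ_self n), ← coeff_map, map_sum,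
      Finset.sum_eq_single 0]
    · have e0 : coeff 0 (PowerSeries.map ((Polynomial.aeval (X : XSeries) :
          Polynomial ℂ →ₐ[ℂ] XSeries) : Polynomial ℂ →+* XSeries) F)
          = Polynomial.aeval (X : XSeries) (constantCoeff F) := by
        rw [coeff_map, coeff_zero_eq_constantCoeff_apply]; rfl
      rw [pow_zero, mul_one, e0, Polynomial.coeff_coe]
      have : PowerSeries.map (Polynomial.evalRingHom (0 : ℂ))
          (Polynomial.aeval (X : XSeries) (constantCoeff F))
            = ((constantCoeff F : Polynomial ℂ) : ℂ⟦X⟧) := by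
        rw [Polynomial.aeval_def, Polynomial.hom_eval₂, map_X]
        conv_rhs => rw [← Polynomial.eval₂_C_X (p := constantCoeff F)]
        rw [← Polynomial.coeToPowerSeries.ringHom_apply, Polynomial.hom_eval₂]
        simp only [Polynomial.coeToPowerSeries.ringHom_apply, Polynomial.coe_X]
        congr 1
        ext c n
        simp [coeff_C, PowerSeries.algebraMap_apply]
      rw [this, Polynomial.coeff_coe]
    · intro k _ hk
      rw [map_mul, map_pow, key, zero_pow hk, mul_zero]
    · simp
  rw [RingHom.comp_apply, hF, map_zero] at h1
  exact Polynomial.coe_eq_zero_iff.1 h1.symm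

/-- Liouville's theorem on the kernel curve: if `F(x; t) = F(y; t)` there and `F` vanishes at
`x = 0`, then `F = 0`. At `y = 0` (hence `t = 0`) the lowest coefficient in `t` of such an `F`
equals its own constant term. -/
theorem eq_zero_of_evalAtX_eq_evalAtY {F : XSeries} (h0 : atZero F = 0)
    (h : evalAtX F = evalAtY F) : F = 0 := by
  by_contra hne
  obtain ⟨F₀, hF₀⟩ := X_pow_order_dvd (φ := F)
  have h1 := coeff_order hne
  generalize F.order.toNat = v at h1 hF₀
  have h2 := coeff_X_pow_mul F₀ v 0
  rw [zero_add, ← hF₀, coeff_zero_eq_constantCoeff_apply] at h2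
  have h3 : evalAtX F₀ = evalAtY F₀ := by
    rw [hF₀, map_mul, map_mul, map_pow, map_pow, evalAtX_X, evalAtY_X] at h
    exact mul_left_cancel₀ (pow_ne_zero _ kernelT_ne_zero) h
  have h4 := congrArg constantCoeff h3
  rw [constantCoeff_evalAtX, constantCoeff_evalAtY, ← h2, ← coeff_atZero, h0] at h4
  rw [h4] at h1
  simp at h1

end Kernel

/-! ### The field of series and its invariants -/

section Invariants

open PowerSeries

/-- The fraction field of the power series in `t`. -/
abbrev TField : Type := FractionRing ℂ⟦X⟧

/-- The fraction field of `XSeries`. -/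
abbrev XField : Type := FractionRing XSeries

/-- The elements of `XSeries` as elements of the fraction field. -/
noncomputable abbrev toXField : XSeries →+* XField := algebraMap XSeries XField

lemma toXField_injective : Function.Injective toXField := IsFractionRing.injective _ _

/-- Fractions of series in `t` alone. -/
noncomputable def coefX : TField →+* XField :=
  IsFractionRing.lift (g := toXField.comp tSeries)
    (toXField_injective.comp tSeries_injective)

lemma coefX_algebraMap (q : ℂ⟦X⟧) : coefX (algebraMap ℂ⟦X⟧ TField q) = toXField (tSeries q) :=
  IsFractionRing.lift_algebraMap _ _

/-- `evalAtX` on fractions: a function of `x` on the kernel curve. -/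
noncomputable def onX : XField →+* XField :=
  IsFractionRing.lift (g := toXField.comp evalAtX) (toXField_injective.comp evalAtX_injective)

/-- `evalAtY` on fractions: a function of `y` on the kernel curve. -/
noncomputable def onY : XField →+* XField :=
  IsFractionRing.lift (g := toXField.comp evalAtY) (toXField_injective.comp evalAtY_injective)

lemma onX_toXField (F : XSeries) : onX (toXField F) = toXField (evalAtX F) :=
  IsFractionRing.lift_algebraMap _ _

lemma onY_toXField (F : XSeries) : onY (toXField F) = toXField (evalAtY F) :=
  IsFractionRing.lift_algebraMap _ _

lemma onX_coefX (q : TField) : onX (coefX q) = onY (coefX q) := by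
  have : onX.comp coefX = onY.comp coefX := by
    refine IsLocalization.ringHom_ext (nonZeroDivisors ℂ⟦X⟧) (RingHom.ext fun q => ?_)
    simp only [RingHom.comp_apply, coefX_algebraMap, onX_toXField, onY_toXField, evalAtX_tSeries]
  exact congrArg (fun f : TField →+* XField => f q) this

/-- The variable `x` in the field. -/
noncomputable def xF : XField := toXField xVar

/-- The variable `t` in the field; on the kernel curve the same element is the variable `y`. -/
noncomputable def tF : XField := toXField X

lemma xF_ne_zero : xF ≠ 0 := by
  rw [xF, Ne, map_eq_zero_iff _ toXField_injective]; exact xVar_ne_zero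

lemma tF_ne_zero : tF ≠ 0 := by
  rw [tF, Ne, map_eq_zero_iff _ toXField_injective]; exact X_ne_zero

lemma coefX_X : coefX (algebraMap ℂ⟦X⟧ TField X) = tF := by
  rw [coefX_algebraMap, tSeries_X, tF]

/-- `t` as a function on the kernel curve. -/
noncomputable def kerT : XField := toXField kernelT

lemma kerT_ne_zero : kerT ≠ 0 := by
  rw [kerT, Ne, map_eq_zero_iff _ toXField_injective]; exact kernelT_ne_zero

/-- On the kernel curve `x + y + z = 1 / t`, where `z = 1 / (x * y)`. -/
lemma kerT_mul : kerT * (1 + xF ^ 2 * tF + xF * tF ^ 2) = xF * tF := by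
  simpa [kerT, xF, tF] using congrArg toXField kernelT_mul

@[simp] lemma onX_xF : onX xF = xF := by rw [xF, onX_toXField, evalAtX_xVar]

@[simp] lemma onY_xF : onY xF = tF := by rw [xF, onY_toXField, evalAtY_xVar, tF]

@[simp] lemma onX_tF : onX tF = kerT := by rw [tF, onX_toXField, evalAtX_X, kerT]

@[simp] lemma onY_tF : onY tF = kerT := by rw [tF, onY_toXField, evalAtY_X, kerT]

/-- The elements of `XField` whose only denominators are powers of `x` and `t`. -/
noncomputable def polarRing : Subring XField where
  carrier := {φ | ∃ (a b : ℕ) (F : XSeries), xF ^ a * tF ^ b * φ = toXField F}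
  mul_mem' := by
    rintro φ ψ ⟨a, b, F, hF⟩ ⟨a', b', G, hG⟩
    exact ⟨a + a', b + b', F * G, by rw [map_mul, ← hF, ← hG]; ring⟩
  one_mem' := ⟨0, 0, 1, by simp⟩
  add_mem' := by
    rintro φ ψ ⟨a, b, F, hF⟩ ⟨a', b', G, hG⟩
    refine ⟨a + a', b + b', xVar ^ a' * X ^ b' * F + xVar ^ a * X ^ b * G, ?_⟩
    simp only [map_add, map_mul, map_pow, ← hF, ← hG, ← xF.eq_def, ← tF.eq_def]
    ring
  zero_mem' := ⟨0, 0, 0, by simp⟩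
  neg_mem' := by
    rintro φ ⟨a, b, F, hF⟩
    exact ⟨a, b, -F, by rw [map_neg, ← hF]; ring⟩

lemma toXField_mem_polarRing (F : XSeries) : toXField F ∈ polarRing := ⟨0, 0, F, by simp⟩

lemma xF_mem_polarRing : xF ∈ polarRing := toXField_mem_polarRing _

lemma xF_inv_mem_polarRing : xF⁻¹ ∈ polarRing :=
  ⟨1, 0, 1, by simp [xF_ne_zero]⟩

lemma tF_inv_mem_polarRing : tF⁻¹ ∈ polarRing :=
  ⟨0, 1, 1, by simp [tF_ne_zero]⟩

/-- The invariant `x * y + y * z + z * x` of the kernel curve, expressed through `x`. It generates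
the functions that depend on neither the choice nor the order of the three coordinates. -/
noncomputable def curveInv : XField := xF⁻¹ + xF * tF⁻¹ - xF ^ 2

lemma onX_curveInv : onX curveInv = onY curveInv := by
  simp only [curveInv, map_sub, map_add, map_mul, map_inv₀, map_pow, onX_xF, onX_tF, onY_xF,
    onY_tF]
  have h := kerT_mul
  have h1 := xF_ne_zero
  have h2 := tF_ne_zero
  have h3 := kerT_ne_zero
  field_simp
  linear_combination (tF - xF) * h

/-- Every invariant with poles only at `x = 0` is a polynomial in `curveInv`: subtracting multiples
of powers of `curveInv` removes the poles at `x = 0`, and Liouville's theorem applies. -/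
theorem exists_eq_eval_curveInv {φ : XField} (hφ : φ ∈ polarRing) (hinv : onX φ = onY φ) :
    ∃ P : Polynomial TField, φ = P.eval₂ coefX curveInv := by
  obtain ⟨a, b, F, hF⟩ := hφ
  have ht := tF_ne_zero
  have hx := xF_ne_zero
  have hT : algebraMap ℂ⟦X⟧ TField X ≠ 0 := by
    rw [Ne, map_eq_zero_iff _ (IsFractionRing.injective ℂ⟦X⟧ TField)]; exact X_ne_zero
  induction a generalizing φ b F with
  | zero =>
    have h1 : evalAtX F = evalAtY F := by
      apply toXField_injective
      rw [← onX_toXField, ← onY_toXField, ← hF]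
      simp [hinv]
    have h2 : F = tSeries (atZero F) := by
      rw [← sub_eq_zero]
      refine eq_zero_of_evalAtX_eq_evalAtY (by simp) ?_
      rw [map_sub, map_sub, h1, evalAtX_tSeries]
    refine ⟨Polynomial.C ((algebraMap ℂ⟦X⟧ TField X ^ b)⁻¹ *
      algebraMap ℂ⟦X⟧ TField (atZero F)), ?_⟩
    rw [Polynomial.eval₂_C, map_mul, map_inv₀, map_pow, coefX_X, coefX_algebraMap, ← h2, ← hF]
    field_simp
  | succ a ih =>
    set η : XSeries := X + xVar ^ 2 - X * xVar ^ 3 with hη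
    have hη' : toXField η = xF * tF * curveInv := by
      simp only [hη, map_add, map_sub, map_mul, map_pow, ← xF.eq_def, ← tF.eq_def, curveInv]
      field_simp
    set q := atZero F with hq
    obtain ⟨G, hG⟩ : ∃ G, X ^ (a + 1) * F - tSeries q * η ^ (a + 1) = xVar * G := by
      apply exists_eq_mul_of_atZero
      simp [hη, hq, mul_comm]
    have hG' : tF ^ (a + 1) * (xF ^ (a + 1) * tF ^ b * φ)
        - coefX (algebraMap ℂ⟦X⟧ TField q) * (xF * tF * curveInv) ^ (a + 1)
          = xF * toXField G := by
      rw [hF, coefX_algebraMap, ← hη', xF, tF, ← map_pow, ← map_pow, ← map_mul, ← map_mul,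
        ← map_sub, hG, map_mul]
    obtain ⟨P, hP⟩ := ih (φ := tF ^ b * φ - coefX (algebraMap ℂ⟦X⟧ TField q) * curveInv ^ (a + 1))
      (by simp only [map_sub, map_mul, map_pow, onX_tF, onY_tF, hinv, onX_coefX, onX_curveInv])
      (a + 1) G (by
        apply mul_left_cancel₀ hx
        rw [← hG']
        ring)
    refine ⟨Polynomial.C ((algebraMap ℂ⟦X⟧ TField X ^ b)⁻¹) *
      (P + Polynomial.C (algebraMap ℂ⟦X⟧ TField q) * Polynomial.X ^ (a + 1)), ?_⟩
    rw [Polynomial.eval₂_mul, Polynomial.eval₂_add, ← hP, Polynomial.eval₂_C, Polynomial.eval₂_mul,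
      Polynomial.eval₂_C, Polynomial.eval₂_pow, Polynomial.eval₂_X, map_inv₀, map_pow, coefX_X]
    field_simp
    ring

end Invariants

/-! ### Laurent expansions in `x` and derivations of their coefficients -/

section Expansion

open PowerSeries

/-- The fraction field of the power series in `x` over the field `TField`. -/
abbrev ExpansionField : Type := FractionRing TField⟦X⟧

/-- The expansion of an element of `XSeries` in powers of `x`. -/
noncomputable def expansion : XSeries →+* TField⟦X⟧ :=
  (PowerSeries.map (algebraMap ℂ⟦X⟧ TField)).comp swapSeries

lemma expansion_injective : Function.Injective expansion :=
  (PowerSeries.map_injective _ (IsFractionRing.injective ℂ⟦X⟧ TField)).comp swapSeries_injective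

lemma constantCoeff_expansion (F : XSeries) :
    constantCoeff (expansion F) = algebraMap ℂ⟦X⟧ TField (atZero F) := by
  rw [expansion, RingHom.comp_apply, ← coeff_zero_eq_constantCoeff_apply, coeff_map,
    coeff_zero_eq_constantCoeff_apply]
  rfl

lemma expansion_tSeries (q : ℂ⟦X⟧) : expansion (tSeries q) = C (algebraMap ℂ⟦X⟧ TField q) := by
  simp [expansion, tSeries]

lemma expansion_xVar : expansion xVar = X := by simp [expansion, xVar]

/-- The extension of `expansion` to fractions. -/
noncomputable def expandX : XField →+* ExpansionField :=
  IsFractionRing.lift (g := (algebraMap TField⟦X⟧ ExpansionField).comp expansion)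
    ((IsFractionRing.injective TField⟦X⟧ ExpansionField).comp expansion_injective)

lemma expandX_toXField (F : XSeries) :
    expandX (toXField F) = algebraMap TField⟦X⟧ ExpansionField (expansion F) :=
  IsFractionRing.lift_algebraMap _ _

lemma expandX_coefX (q : TField) :
    expandX (coefX q) = algebraMap TField⟦X⟧ ExpansionField (C q) := by
  have : expandX.comp coefX = (algebraMap TField⟦X⟧ ExpansionField).comp C := by
    refine IsLocalization.ringHom_ext (nonZeroDivisors ℂ⟦X⟧) (RingHom.ext fun q => ?_)
    simp only [RingHom.comp_apply, coefX_algebraMap, expandX_toXField, expansion_tSeries]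
  exact congrArg (fun f : TField →+* ExpansionField => f q) this

/-- `curveInv` has a pole at `x = 0`, so it is transcendental over the field of coefficients. -/
lemma eval_curveInv_injective :
    Function.Injective (Polynomial.eval₂RingHom coefX curveInv) := by
  rw [injective_iff_map_eq_zero]
  intro P hP
  by_contra hne
  set T : TField := algebraMap ℂ⟦X⟧ TField X with hT
  set ι := algebraMap TField⟦X⟧ ExpansionField with hι
  have hx0 := xF_ne_zero
  have hIx : ι (1 + X ^ 2 * C T⁻¹ - X ^ 3) = ι X * expandX curveInv := by
    have h1 : ι X = expandX xF := by rw [xF, expandX_toXField, expansion_xVar]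
    have h2 : ι (C T⁻¹) = expandX tF⁻¹ := by rw [← expandX_coefX, map_inv₀, hT, coefX_X]
    rw [map_sub, map_add, map_mul, map_pow, map_pow, map_one, h1, h2, ← map_mul, ← map_pow,
      ← map_pow, ← map_mul, ← map_one expandX, ← map_add, ← map_sub]
    congr 1
    rw [curveInv]
    field_simp
  have h1 : ι X ^ P.natDegree * expandX (P.eval₂ coefX curveInv) = 0 := by
    have : P.eval₂ coefX curveInv = 0 := hP
    rw [this, map_zero, mul_zero]
  rw [Polynomial.eval₂_eq_sum_range, map_sum, Finset.mul_sum] at h1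
  have h2 : ∀ i ∈ Finset.range (P.natDegree + 1),
      ι X ^ P.natDegree * expandX (coefX (P.coeff i) * curveInv ^ i)
        = ι (C (P.coeff i) * X ^ (P.natDegree - i) * (1 + X ^ 2 * C T⁻¹ - X ^ 3) ^ i) := by
    intro i hi
    have hi' : i ≤ P.natDegree := Nat.lt_succ_iff.1 (Finset.mem_range.1 hi)
    rw [map_mul ι, map_mul ι, map_pow ι, map_pow ι, hIx, map_mul, map_pow, expandX_coefX]
    conv_lhs => rw [← Nat.sub_add_cancel hi']
    ring
  rw [Finset.sum_congr rfl h2, ← map_sum, map_eq_zero_iff _ (IsFractionRing.injective _ _)] at h1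
  have h3 := congrArg constantCoeff h1
  rw [map_sum, Finset.sum_eq_single P.natDegree] at h3
  · simp at h3
    exact hne h3
  · intro i hi hin
    have : P.natDegree - i ≠ 0 := by
      have := Finset.mem_range.1 hi
      omega
    simp [this]
  · simp

/-- A derivation of the coefficient field acts on power series coefficient by coefficient. -/
noncomputable def coeffDerivation (d : Derivation ℂ TField TField) :
    Derivation ℂ TField⟦X⟧ TField⟦X⟧ where
  toFun F := mk fun n => d (coeff n F)
  map_add' F G := by ext n; simp
  map_smul' m F := by
    ext n
    simp only [coeff_smul, coeff_mk, RingHom.id_apply, Derivation.map_smul]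
  map_one_eq_zero' := by
    ext n
    change coeff n (mk fun n => d (coeff n 1)) = coeff n 0
    rw [coeff_mk, coeff_one]
    split_ifs <;> simp
  leibniz' F G := by
    ext n
    change coeff n (mk fun n => d (coeff n (F * G))) =
      coeff n (F • (mk fun n => d (coeff n G)) + G • (mk fun n => d (coeff n F)))
    rw [smul_eq_mul, smul_eq_mul, mul_comm G, map_add, coeff_mk, coeff_mul, coeff_mul, coeff_mul,
      map_sum, ← Finset.sum_add_distrib]
    refine Finset.sum_congr rfl fun p _ => ?_
    rw [Derivation.leibniz, coeff_mk, coeff_mk, smul_eq_mul, smul_eq_mul]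
    ring

lemma coeff_coeffDerivation (d : Derivation ℂ TField TField) (F : TField⟦X⟧) (n : ℕ) :
    coeff n (coeffDerivation d F) = d (coeff n F) := by
  change coeff n (mk fun n => d (coeff n F)) = _
  rw [coeff_mk]

/-- The action of a derivation on the coefficients of power series extends to their fractions. -/
lemma exists_expansionDerivation (d : Derivation ℂ TField TField) :
    ∃ D : Derivation ℂ ExpansionField ExpansionField, ∀ F : TField⟦X⟧,
      D (algebraMap TField⟦X⟧ ExpansionField F)
        = algebraMap TField⟦X⟧ ExpansionField (coeffDerivation d F) := by
  have : Algebra.FormallyEtale TField⟦X⟧ ExpansionField :=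
    Algebra.FormallyEtale.of_isLocalization (nonZeroDivisors TField⟦X⟧)
  obtain ⟨D, hD⟩ := Derivation.exists_extend_of_formallyEtale ℂ TField⟦X⟧ ExpansionField
    ((Algebra.linearMap TField⟦X⟧ ExpansionField).compDer (coeffDerivation d))
  exact ⟨D, hD⟩

section Derivation

variable {δ : Derivation ℂ TField TField} {D : Derivation ℂ ExpansionField ExpansionField}
  (hD : ∀ F : TField⟦X⟧, D (algebraMap TField⟦X⟧ ExpansionField F)
    = algebraMap TField⟦X⟧ ExpansionField (coeffDerivation δ F))

include hD

lemma derivation_expandX_toXField_eq_zero {F : XSeries}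
    (h : D (expandX (toXField F)) = 0) (i : ℕ) : δ (coeff i (expansion F)) = 0 := by
  rw [expandX_toXField, hD, map_eq_zero_iff _ (IsFractionRing.injective _ _)] at h
  rw [← coeff_coeffDerivation, h, map_zero]

lemma derivation_atZero_eq_zero {F : XSeries}
    (h : D (expandX (toXField F)) = 0) : δ (algebraMap ℂ⟦X⟧ TField (atZero F)) = 0 := by
  rw [← constantCoeff_expansion, ← coeff_zero_eq_constantCoeff_apply]
  exact derivation_expandX_toXField_eq_zero hD h 0

lemma derivation_expandX_coefX {q : TField} (hq : δ q = 0) : D (expandX (coefX q)) = 0 := by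
  rw [expandX_coefX, hD, map_eq_zero_iff _ (IsFractionRing.injective _ _)]
  ext n
  rw [coeff_coeffDerivation, coeff_C]
  split_ifs <;> simp [hq]

lemma derivation_expandX_tF (ht : δ (algebraMap ℂ⟦X⟧ TField X) = 0) : D (expandX tF) = 0 := by
  rw [← coefX_X]
  exact derivation_expandX_coefX hD ht

lemma derivation_expandX_xF : D (expandX xF) = 0 := by
  rw [xF, expandX_toXField, hD, expansion_xVar, map_eq_zero_iff _ (IsFractionRing.injective _ _)]
  ext n
  rw [coeff_coeffDerivation, coeff_X]
  split_ifs <;> simp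

lemma derivation_expandX_curveInv (ht : δ (algebraMap ℂ⟦X⟧ TField X) = 0) :
    D (expandX curveInv) = 0 := by
  simp only [curveInv, map_add, map_sub, map_mul expandX, map_pow expandX, map_inv₀,
    Derivation.leibniz, Derivation.leibniz_pow, Derivation.leibniz_inv,
    derivation_expandX_xF hD, derivation_expandX_tF hD ht, smul_zero, add_zero, sub_zero]

end Derivation

/-- A power series killed by every derivation that kills the polynomials is algebraic. -/
lemma isAlgebraic_of_derivation {E : ℂ⟦X⟧}
    (h : ∀ d : Derivation ℂ TField TField,
      d (algebraMap ℂ⟦X⟧ TField X) = 0 → d (algebraMap ℂ⟦X⟧ TField E) = 0) :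
    IsAlgebraic (Polynomial ℂ) E := by
  have hmap : ∀ p : Polynomial ℂ, algebraMap (Polynomial ℂ) ℂ⟦X⟧ p = (p : ℂ⟦X⟧) := fun p => by
    rw [PowerSeries.algebraMap_apply']
    simp
  have hinj : Function.Injective (algebraMap (Polynomial ℂ) ℂ⟦X⟧) := by
    intro p q hpq
    rw [hmap, hmap] at hpq
    exact Polynomial.coe_injective ℂ hpq
  have : FaithfulSMul (Polynomial ℂ) ℂ⟦X⟧ := (faithfulSMul_iff_algebraMap_injective _ _).2 hinj
  have hinj2 : Function.Injective (algebraMap (Polynomial ℂ) TField) := by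
    rw [IsScalarTower.algebraMap_eq (Polynomial ℂ) ℂ⟦X⟧ TField]
    exact (IsFractionRing.injective ℂ⟦X⟧ TField).comp hinj
  have : FaithfulSMul (Polynomial ℂ) TField := (faithfulSMul_iff_algebraMap_injective _ _).2 hinj2
  let K := FractionRing (Polynomial ℂ)
  let _ : Algebra K TField := FractionRing.liftAlgebra (Polynomial ℂ) TField
  have : IsScalarTower (Polynomial ℂ) K TField := FractionRing.isScalarTower_liftAlgebra _ _
  have : CharZero K := charZero_of_injective_algebraMap (IsFractionRing.injective (Polynomial ℂ) K)
  rw [← isAlgebraic_algebraMap_iff (IsFractionRing.injective ℂ⟦X⟧ TField)]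
  rw [IsFractionRing.isAlgebraic_iff (Polynomial ℂ) K TField]
  by_contra htr
  obtain ⟨d, hd⟩ := Transcendental.exists_derivation_eq_one htr
  have hker : ∀ p : Polynomial ℂ, d (algebraMap ℂ⟦X⟧ TField (p : ℂ⟦X⟧)) = 0 := by
    intro p
    rw [← hmap, ← IsScalarTower.algebraMap_apply (Polynomial ℂ) ℂ⟦X⟧ TField,
      IsScalarTower.algebraMap_apply (Polynomial ℂ) K TField]
    exact d.map_algebraMap _
  have : IsScalarTower ℂ K TField := IsScalarTower.of_algebraMap_eq fun c => by
    rw [IsScalarTower.algebraMap_apply ℂ (Polynomial ℂ) K,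
      ← IsScalarTower.algebraMap_apply (Polynomial ℂ) K TField,
      ← IsScalarTower.algebraMap_apply ℂ (Polynomial ℂ) TField]
  have := h (d.restrictScalars ℂ) (by simpa using hker Polynomial.X)
  rw [Derivation.restrictScalars_apply, hd] at this
  exact one_ne_zero this

end Expansion

/-! ### Power sums of two conjugate functions -/

section PowerSums

variable {R : Type*} [CommRing R]

/-- The power sum `u ^ n + v ^ n` in terms of `T = u + v` and `N = u * v`. -/
def powerSum (T N : R) : ℕ → R
  | 0 => 2
  | 1 => T
  | n + 2 => T * powerSum T N (n + 1) - N * powerSum T N n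

/-- The quotient `(u ^ n - v ^ n) / (u - v)` in terms of `T = u + v` and `N = u * v`. -/
def lucasSeq (T N : R) : ℕ → R
  | 0 => 0
  | 1 => 1
  | n + 2 => T * lucasSeq T N (n + 1) - N * lucasSeq T N n

lemma powerSum_add_mul (u v : R) (n : ℕ) : powerSum (u + v) (u * v) n = u ^ n + v ^ n := by
  induction n using Nat.twoStepInduction with
  | zero => rw [powerSum]; ring
  | one => rw [powerSum]; ring
  | more n h1 h2 => rw [powerSum, h1, h2]; ring

lemma sub_mul_lucasSeq (u v : R) (n : ℕ) :
    (u - v) * lucasSeq (u + v) (u * v) n = u ^ n - v ^ n := by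
  induction n using Nat.twoStepInduction with
  | zero => rw [lucasSeq]; ring
  | one => rw [lucasSeq]; ring
  | more n h1 h2 => rw [lucasSeq]; linear_combination (u + v) * h2 - u * v * h1

lemma powerSum_succ_eq (T N : R) (n : ℕ) :
    powerSum T N (n + 1) = lucasSeq T N (n + 2) - N * lucasSeq T N n := by
  induction n using Nat.twoStepInduction with
  | zero => simp [powerSum, lucasSeq]
  | one => simp only [powerSum, lucasSeq]; ring
  | more n h1 h2 =>
    rw [powerSum, h1, h2]
    simp only [lucasSeq]
    ring

lemma map_powerSum {S : Type*} [CommRing S] (f : R →+* S) (T N : R) (n : ℕ) :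
    f (powerSum T N n) = powerSum (f T) (f N) n := by
  induction n using Nat.twoStepInduction with
  | zero => exact map_ofNat f 2
  | one => rfl
  | more n h1 h2 => simp [powerSum, h1, h2]

lemma map_lucasSeq {S : Type*} [CommRing S] (f : R →+* S) (T N : R) (n : ℕ) :
    f (lucasSeq T N n) = lucasSeq (f T) (f N) n := by
  induction n using Nat.twoStepInduction with
  | zero => simp [lucasSeq]
  | one => simp [lucasSeq]
  | more n h1 h2 => simp [lucasSeq, h1, h2]

lemma powerSum_mem (A : Subring R) {T N : R} (hT : T ∈ A) (hN : N ∈ A) (n : ℕ) :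
    powerSum T N n ∈ A := by
  induction n using Nat.twoStepInduction with
  | zero => exact ofNat_mem A 2
  | one => exact hT
  | more n h1 h2 => exact sub_mem (mul_mem hT h2) (mul_mem hN h1)

lemma lucasSeq_mem (A : Subring R) {T N : R} (hT : T ∈ A) (hN : N ∈ A) (n : ℕ) :
    lucasSeq T N n ∈ A := by
  induction n using Nat.twoStepInduction with
  | zero => exact zero_mem A
  | one => exact one_mem A
  | more n h1 h2 => exact sub_mem (mul_mem hT h2) (mul_mem hN h1)

/-- The derivative of the `n`-th power sum with respect to `T` is `n * lucasSeq T N n`. -/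
lemma derivation_powerSum {k : Type*} [CommRing k] [Algebra k R] (D : Derivation k R R)
    {T N : R} (hN : D N = 0) (n : ℕ) :
    D (powerSum T N n) = n * lucasSeq T N n * D T := by
  induction n using Nat.twoStepInduction with
  | zero =>
    rw [powerSum, ← Nat.cast_ofNat, Derivation.map_natCast]
    simp
  | one => simp [powerSum, lucasSeq]
  | more n h1 h2 =>
    rw [powerSum, map_sub, Derivation.leibniz, Derivation.leibniz, h1, h2, hN, powerSum_succ_eq]
    simp only [smul_eq_mul, lucasSeq]
    push_cast
    ring

end PowerSums

/-! ### The discriminant of the kernel curve -/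

section Discriminant

open Polynomial

instance : CharZero TField := charZero_of_injective_algebraMap (algebraMap ℂ TField).injective

/-- The inverse of the variable `t`. -/
noncomputable def tInv : TField := (algebraMap ℂ⟦X⟧ TField PowerSeries.X)⁻¹

lemma coefX_tInv : coefX tInv = tF⁻¹ := by rw [tInv, map_inv₀, coefX_X]

/-- The discriminant of `Z ^ 3 - Z ^ 2 / t + J * Z - 1`, the cubic polynomial whose roots are
`x`, `y`, `z`, as a polynomial in `J`. -/
noncomputable def discPoly : TField[X] :=
  C (-4) * X ^ 3 + C (tInv ^ 2) * X ^ 2 + C (18 * tInv) * X + C (-(4 * tInv ^ 3 + 27))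

lemma natDegree_discPoly : discPoly.natDegree = 3 := natDegree_cubic (by norm_num)

lemma tInv_pow_ne : tInv ^ 3 ≠ 27 := by
  intro h
  have hX : algebraMap ℂ⟦X⟧ TField PowerSeries.X ≠ 0 := by
    rw [Ne, map_eq_zero_iff _ (IsFractionRing.injective ℂ⟦X⟧ TField)]
    exact PowerSeries.X_ne_zero
  have h1 : algebraMap ℂ⟦X⟧ TField (27 * PowerSeries.X ^ 3) = algebraMap ℂ⟦X⟧ TField 1 := by
    rw [map_mul, map_pow, map_ofNat, map_one, ← h, tInv, inv_pow]
    field_simp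
  have h2 := congrArg PowerSeries.constantCoeff (IsFractionRing.injective ℂ⟦X⟧ TField h1)
  simp at h2

lemma squarefree_discPoly : Squarefree discPoly := by
  apply Separable.squarefree
  set c : TField[X] := C tInv with hc
  have hD : discPoly = -4 * X ^ 3 + c ^ 2 * X ^ 2 + 18 * c * X - (4 * c ^ 3 + 27) := by
    simp only [discPoly, C_mul, C_neg, C_add, C_pow, map_ofNat, ← hc]
    ring
  have hd : derivative discPoly = -12 * X ^ 2 + 2 * c ^ 2 * X + 18 * c := by
    simp only [hD, hc, derivative_add, derivative_sub, derivative_mul, derivative_C, derivative_pow,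
      derivative_X, derivative_neg, derivative_ofNat]
    simp only [Nat.cast_ofNat, map_ofNat]
    ring
  -- Euclid's algorithm: `36 * D - (12 * X - c ^ 2) * D'` is linear, equal to `l * X + m`
  set l : TField[X] := 2 * c * (c ^ 3 + 216) with hl
  set m : TField[X] := -18 * (7 * c ^ 3 + 54) with hm
  set S : TField[X] := -12 * l * X + (2 * c ^ 2 * l + 12 * m) with hS
  have key : l ^ 2 * derivative discPoly
      - (36 * discPoly - (12 * X - c ^ 2) * derivative discPoly) * S
      = C (576 * (tInv ^ 3 - 27) ^ 3) := by
    simp only [C_mul, C_pow, C_sub, map_ofNat, ← hc]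
    rw [hd, hD, hS, hl, hm]
    ring
  have hne : 576 * (tInv ^ 3 - 27) ^ 3 ≠ 0 :=
    mul_ne_zero (by norm_num) (pow_ne_zero _ (sub_ne_zero.2 tInv_pow_ne))
  set g : TField := 576 * (tInv ^ 3 - 27) ^ 3 with hg
  have hu : C g⁻¹ * C g = 1 := by rw [← C_mul, inv_mul_cancel₀ hne, C_1]
  refine ⟨-C g⁻¹ * 36 * S, C g⁻¹ * (l ^ 2 + (12 * X - c ^ 2) * S), ?_⟩
  linear_combination hu + C g⁻¹ * key

end Discriminant

/-! ### Algebraicity of conjugate functions whose powers are invariant -/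

section Dichotomy

open PowerSeries

lemma coefX_algebraMap_complex (c : ℂ) : coefX (algebraMap ℂ TField c) = algebraMap ℂ XField c := by
  rw [IsScalarTower.algebraMap_apply ℂ ℂ⟦X⟧ TField, coefX_algebraMap,
    IsScalarTower.algebraMap_apply ℂ XSeries XField, PowerSeries.algebraMap_apply,
    PowerSeries.algebraMap_apply, tSeries, PowerSeries.map_C,
    Polynomial.algebraMap_apply]

lemma onX_algebraMap_complex (c : ℂ) : onX (algebraMap ℂ XField c) = algebraMap ℂ XField c := by
  rw [IsScalarTower.algebraMap_apply ℂ XSeries XField, onX_toXField, PowerSeries.algebraMap_apply,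
    evalAtX, substSeries_C, Polynomial.algebraMap_apply, Polynomial.aeval_C,
    PowerSeries.algebraMap_apply, Polynomial.algebraMap_apply]
  rfl

lemma onY_algebraMap_complex (c : ℂ) : onY (algebraMap ℂ XField c) = algebraMap ℂ XField c := by
  rw [← coefX_algebraMap_complex, ← onX_coefX, coefX_algebraMap_complex, onX_algebraMap_complex]

/-- The third coordinate `z = 1 / (x * y)` on the kernel curve. -/
noncomputable def zF : XField := (xF * tF)⁻¹

lemma xF_mul_tF_mul_zF : xF * tF * zF = 1 :=
  mul_inv_cancel₀ (mul_ne_zero xF_ne_zero tF_ne_zero)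

lemma kerT_inv : kerT⁻¹ = xF + tF + zF := by
  have h := kerT_mul
  have h1 := xF_ne_zero
  have h2 := tF_ne_zero
  have h3 := kerT_ne_zero
  rw [zF]
  field_simp
  linear_combination -h

/-- The product of the differences of the three coordinates on the kernel curve. -/
noncomputable def curveDiff : XField := (xF - tF) * (tF - zF) * (zF - xF)

lemma onX_eval_discPoly :
    onX (discPoly.eval₂ coefX curveInv) = curveDiff ^ 2 := by
  have hz := xF_mul_tF_mul_zF
  have hx := xF_ne_zero
  have hxi : xF⁻¹ = tF * zF := by
    exact (eq_inv_of_mul_eq_one_left (by linear_combination hz)).symm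
  have hI : onX curveInv = xF * tF + tF * zF + zF * xF := by
    simp only [curveInv, map_sub, map_add, map_mul, map_inv₀, map_pow, onX_xF, onX_tF, kerT_inv]
    rw [hxi]
    ring
  rw [discPoly]
  simp only [Polynomial.eval₂_add, Polynomial.eval₂_mul, Polynomial.eval₂_C, Polynomial.eval₂_X,
    Polynomial.eval₂_pow, map_add, map_mul, map_neg, map_pow, map_ofNat, coefX_tInv, map_inv₀,
    onX_tF, kerT_inv, hI, curveDiff, Polynomial.eval₂_neg, Polynomial.eval₂_ofNat]
  linear_combination (27 - 18 * (xF + tF + zF) * (xF * tF + tF * zF + zF * xF)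
    + 4 * (xF + tF + zF) ^ 3 + 27 * (xF * tF * zF)) * hz

/-- An element with a power equal to one is a complex constant. -/
lemma exists_complex_of_pow_eq_one {K : Type*} [Field K] [Algebra ℂ K] {a : K} {n : ℕ}
    (hn : 0 < n) (h : a ^ n = 1) : ∃ c : ℂ, algebraMap ℂ K c = a := by
  have hint : IsIntegral ℂ a := IsIntegral.of_pow hn (h ▸ isIntegral_one)
  exact minpoly.mem_range_of_degree_eq_one ℂ a
    (IsAlgClosed.degree_eq_one_of_irreducible ℂ (minpoly.irreducible hint))

lemma derivation_coeff_discPoly {δ : Derivation ℂ TField TField}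
    (ht : δ (algebraMap ℂ⟦X⟧ TField X) = 0) (i : ℕ) : δ (discPoly.coeff i) = 0 := by
  have h1 : δ tInv = 0 := by
    rw [tInv, Derivation.leibniz_inv, ht, smul_zero]
  have h2 : ∀ m : ℕ, [m.AtLeastTwo] → δ (OfNat.ofNat m : TField) = 0 :=
    fun m _ => by rw [← map_ofNat (algebraMap ℂ TField) m]; exact δ.map_algebraMap _
  have key : ∀ a b c d : TField, δ a = 0 → δ b = 0 → δ c = 0 → δ d = 0 →
      δ ((Polynomial.C a * Polynomial.X ^ 3 + Polynomial.C b * Polynomial.X ^ 2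
        + Polynomial.C c * Polynomial.X + Polynomial.C d).coeff i) = 0 := by
    intro a b c d ha hb hc hd
    simp only [Polynomial.coeff_add, Polynomial.coeff_C_mul, Polynomial.coeff_X_pow,
      Polynomial.coeff_X, Polynomial.coeff_C, mul_ite, mul_one, mul_zero, map_add, apply_ite δ,
      map_zero, ha, hb, hc, hd, ite_self, add_zero]
  refine key _ _ _ _ ?_ ?_ ?_ ?_ <;>
    simp only [map_neg, map_add, Derivation.leibniz, Derivation.leibniz_pow, h1, h2, smul_zero,
      neg_zero, add_zero]

/-- A derivation of the expansion field which extends `δ` kills polynomials in `curveInv` whose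
coefficients are killed by `δ`. -/
lemma derivation_eval_curveInv {δ : Derivation ℂ TField TField}
    (ht : δ (algebraMap ℂ⟦X⟧ TField X) = 0) {D : Derivation ℂ ExpansionField ExpansionField}
    (hD : ∀ F : TField⟦X⟧, D (algebraMap TField⟦X⟧ ExpansionField F)
      = algebraMap TField⟦X⟧ ExpansionField (coeffDerivation δ F))
    {P : Polynomial TField} (hP : ∀ i, δ (P.coeff i) = 0) :
    D (expandX (P.eval₂ coefX curveInv)) = 0 := by
  rw [Polynomial.eval₂_eq_sum_range, map_sum, map_sum]
  refine Finset.sum_eq_zero fun i _ => ?_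
  rw [map_mul, map_pow, Derivation.leibniz, Derivation.leibniz_pow,
    derivation_expandX_curveInv hD ht, derivation_expandX_coefX hD (hP i)]
  simp

/-- Let `u` and `v` be conjugate functions on the kernel curve, with sum `T` and product `N`, which
change into `u'` and `v'` when `(x; y, z)` is rotated to `(y; z, x)`. Suppose that the `n`-th powers
do not change and that `N` is a power of `curveInv - r`. Then either `u` and `v` are proportional,
or every derivation that kills `t` kills `r` and `T`. -/
theorem proportional_or_derivation_eq_zero {T N Θ u v u' v' : XField} {n h m : ℕ} {c : ℂ}
    {r : TField} (hT : T ∈ polarRing) (hN : N ∈ polarRing) (hΘ : Θ ∈ polarRing)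
    (hTX : onX T = u + v) (hNX : onX N = u * v) (hΘX : onX Θ = curveDiff * (u - v))
    (hTY : onY T = u' + v') (hNY : onY N = u' * v') (hΘY : onY Θ = curveDiff * (u' - v'))
    (hu : u ^ n = u' ^ n) (hv : v ^ n = v' ^ n) (hn : 0 < n) (hnm : n * m = 2 * h)
    (hc : c ≠ 0) (hNr : N = algebraMap ℂ XField c * (curveInv - coefX r) ^ m) :
    (∃ ζ : ℂ, ζ ≠ 0 ∧ algebraMap ℂ XField ζ * T ^ 2 = algebraMap ℂ XField (1 + ζ) ^ 2 * N) ∨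
    ∀ δ : Derivation ℂ TField TField, δ (algebraMap ℂ⟦X⟧ TField X) = 0 →
      δ r = 0 ∧ ∀ D : Derivation ℂ ExpansionField ExpansionField,
        (∀ F : TField⟦X⟧, D (algebraMap TField⟦X⟧ ExpansionField F)
          = algebraMap TField⟦X⟧ ExpansionField (coeffDerivation δ F)) → D (expandX T) = 0 := by
  classical
  obtain ⟨P, hP⟩ := exists_eq_eval_curveInv (powerSum_mem polarRing hT hN n) (by
    rw [map_powerSum, map_powerSum, hTX, hNX, hTY, hNY, powerSum_add_mul, powerSum_add_mul, hu, hv])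
  obtain ⟨Q, hQ⟩ := exists_eq_eval_curveInv (mul_mem hΘ (lucasSeq_mem polarRing hT hN n)) (by
    rw [map_mul, map_mul, map_lucasSeq, map_lucasSeq, hTX, hNX, hTY, hNY, hΘX, hΘY, mul_assoc,
      mul_assoc, sub_mul_lucasSeq, sub_mul_lucasSeq, hu, hv])
  set c' : TField := algebraMap ℂ TField (4 * c ^ n) with hc'
  set e : Polynomial TField := Polynomial.X - Polynomial.C r with he
  have hc'0 : c' ≠ 0 := by
    rw [hc', Ne, map_eq_zero_iff _ (algebraMap ℂ TField).injective]
    exact mul_ne_zero (by norm_num) (pow_ne_zero _ hc)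
  have heval : (Polynomial.C c' * e ^ (2 * h)).eval₂ coefX curveInv = 4 * N ^ n := by
    rw [Polynomial.eval₂_mul, Polynomial.eval₂_pow, Polynomial.eval₂_C, he, Polynomial.eval₂_sub,
      Polynomial.eval₂_X, Polynomial.eval₂_C, hNr, hc', coefX_algebraMap_complex, ← hnm, mul_pow,
      ← pow_mul, map_mul, map_pow, map_ofNat, mul_comm m n]
    ring
  have hNne : N ≠ 0 := by
    intro h0
    have h1 : (Polynomial.C c' * e ^ (2 * h)) = 0 := by
      apply eval_curveInv_injective
      rw [Polynomial.coe_eval₂RingHom, heval, h0, zero_pow hn.ne', mul_zero, Polynomial.eval₂_zero]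
    exact mul_ne_zero (Polynomial.C_ne_zero.2 hc'0)
      (pow_ne_zero _ (Polynomial.X_sub_C_ne_zero r)) h1
  have hpell : Q ^ 2 = discPoly * (P ^ 2 - Polynomial.C c' * e ^ (2 * h)) := by
    apply eval_curveInv_injective
    rw [Polynomial.coe_eval₂RingHom, Polynomial.eval₂_pow, ← hQ, Polynomial.eval₂_mul,
      Polynomial.eval₂_sub, heval, Polynomial.eval₂_pow, ← hP]
    apply onX.injective
    simp only [map_mul, map_pow, map_sub, map_ofNat, onX_eval_discPoly, map_powerSum, map_lucasSeq,
      hTX, hNX, hΘX, powerSum_add_mul]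
    rw [mul_assoc, sub_mul_lucasSeq]
    ring
  obtain ⟨W, rfl⟩ : discPoly ∣ Q :=
    (squarefree_discPoly.dvd_pow_iff_dvd two_ne_zero).1 (hpell ▸ dvd_mul_right _ _)
  have hdisc : discPoly ≠ 0 := by
    intro h0
    have := natDegree_discPoly
    simp [h0] at this
  have hpell' : P ^ 2 - discPoly * W ^ 2 = Polynomial.C c' * e ^ (2 * h) := by
    apply mul_left_cancel₀ hdisc
    linear_combination -hpell
  by_cases hW : W = 0
  · -- here `u ^ n = v ^ n`, and the ratio `u / v` is a root of unity
    left
    have h1 : (u ^ n + v ^ n) ^ 2 = 4 * (u * v) ^ n := by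
      have h2 := congrArg (fun p => onX (p.eval₂ coefX curveInv)) hpell'
      simp only [hW, heval] at h2
      rw [zero_pow two_ne_zero, mul_zero, sub_zero, Polynomial.eval₂_pow, ← hP, map_pow,
        map_powerSum, hTX, hNX, powerSum_add_mul, map_mul, map_pow, hNX, map_ofNat] at h2
      exact h2
    have h2 : u ^ n = v ^ n := by
      rw [← sub_eq_zero]
      apply pow_eq_zero_iff two_ne_zero |>.1
      linear_combination h1
    have huv : u * v ≠ 0 := by
      rw [← hNX, Ne, map_eq_zero_iff _ onX.injective]; exact hNne
    have hv0 : v ≠ 0 := right_ne_zero_of_mul huv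
    have hu0 : u ≠ 0 := left_ne_zero_of_mul huv
    obtain ⟨ζ, hζ⟩ := exists_complex_of_pow_eq_one (a := u / v) hn
      (by rw [div_pow, h2, div_self (pow_ne_zero _ hv0)])
    refine ⟨ζ, ?_, ?_⟩
    · rintro rfl
      rw [map_zero, eq_comm, div_eq_zero_iff] at hζ
      tauto
    · apply onX.injective
      have hu' : u = algebraMap ℂ XField ζ * v := by rw [hζ]; field_simp
      simp only [map_mul, map_pow, onX_algebraMap_complex, hTX, hNX, map_add, map_one]
      rw [hu']
      ring
  · -- the derivative of the power sum is a nonzero multiple of the derivative of `T`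
    right
    intro δ hδ
    rcases derivation_eq_zero_of_pell δ natDegree_discPoly squarefree_discPoly
      (derivation_coeff_discPoly hδ) hc'0 (δ.map_algebraMap _) hpell' with h0 | ⟨hr, hPd⟩
    · exact absurd h0 hW
    refine ⟨hr, fun D hD => ?_⟩
    have h1 : D (expandX (powerSum T N n)) = 0 := by
      rw [hP]
      exact derivation_eval_curveInv hδ hD hPd
    have h2 : D (expandX N) = 0 := by
      have h3 : D (expandX (curveInv - coefX r)) = 0 := by
        have : curveInv - coefX r = e.eval₂ coefX curveInv := by
          rw [he, Polynomial.eval₂_sub, Polynomial.eval₂_X, Polynomial.eval₂_C]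
        rw [this]
        refine derivation_eval_curveInv hδ hD fun i => ?_
        rw [he, Polynomial.coeff_sub, Polynomial.coeff_X, Polynomial.coeff_C]
        split_ifs <;> simp [hr]
      have h4 : D (expandX (algebraMap ℂ XField c)) = 0 := by
        rw [← coefX_algebraMap_complex, ← Polynomial.eval₂_C coefX curveInv]
        refine derivation_eval_curveInv hδ hD fun i => ?_
        rw [Polynomial.coeff_C]
        split_ifs <;> simp
      rw [hNr, map_mul, map_pow, Derivation.leibniz, Derivation.leibniz_pow, h3, h4]
      simp
    rw [map_powerSum, derivation_powerSum D h2, ← map_lucasSeq] at h1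
    have h3 : lucasSeq T N n ≠ 0 := by
      intro h0
      rw [h0, mul_zero] at hQ
      have h4 : discPoly * W = 0 := by
        apply eval_curveInv_injective
        rw [Polynomial.coe_eval₂RingHom, ← hQ, Polynomial.eval₂_zero]
      exact mul_ne_zero hdisc hW h4
    have h5 : ((n : ℕ) : ExpansionField) ≠ 0 := by
      rw [← map_natCast (algebraMap ℂ ExpansionField), Ne,
        map_eq_zero_iff _ (algebraMap ℂ ExpansionField).injective]
      exact_mod_cast hn.ne'
    have h6 : expandX (lucasSeq T N n) ≠ 0 := by
      rwa [Ne, map_eq_zero_iff _ expandX.injective]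
    exact (mul_eq_zero.1 h1).resolve_left (mul_ne_zero h5 h6)

end Dichotomy

/-! ### Walks in a sector with weighted crossings -/

section Sector

open PowerSeries

/-- The weighted number of walks of length `n` which start at the point `(i, j)` of one of three
congruent sectors of the plane and end at the apex `(0, 0)` of any sector. Inside a sector the steps
are `(-1, 0)`, `(0, -1)` and `(1, 1)`. A step from `(0, j)` may lead to the point `(j - c, 0)` of
the next sector, with weight `s`, and a step from `(i, 0)` to the point `(0, i + 1 + c)` of the
previous one, with weight `s⁻¹`. The cell-centred lattice has `c = 0`, the vertex-centred one `c = 1`. -/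
noncomputable def sectorCount (c : ℕ) (s : ℂ) : ℕ → ℕ → ℕ → ℂ
  | 0, i, j => if i = 0 ∧ j = 0 then 1 else 0
  | n + 1, i, j =>
    (if i = 0 then (if c ≤ j then s * sectorCount c s n (j - c) 0 else 0)
      else sectorCount c s n (i - 1) j) +
    (if j = 0 then s⁻¹ * sectorCount c s n 0 (i + 1 + c) else sectorCount c s n i (j - 1)) +
    sectorCount c s n (i + 1) (j + 1)

variable {c : ℕ} (s : ℂ)

lemma sectorCount_eq_zero (hc : c ≤ 1) {n i j : ℕ} (h : n < i + j) : sectorCount c s n i j = 0 := by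
  induction n generalizing i j with
  | zero =>
    rw [sectorCount, if_neg (by omega)]
  | succ n ih =>
    rw [sectorCount, ih (show n < (i + 1) + (j + 1) by omega)]
    have h1 : (if i = 0 then (if c ≤ j then s * sectorCount c s n (j - c) 0 else 0)
      else sectorCount c s n (i - 1) j) = 0 := by
      split_ifs with h1 h2
      · rw [ih (by omega), mul_zero]
      · rfl
      · exact ih (by omega)
    have h2 : (if j = 0 then s⁻¹ * sectorCount c s n 0 (i + 1 + c)
        else sectorCount c s n i (j - 1)) = 0 := by
      split_ifs with h1
      · rw [ih (by omega), mul_zero]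
      · exact ih (by omega)
    rw [h1, h2]
    ring

/-- The generating function, in `x` and `t`, of the numbers `f n i` for `i ≤ n`. -/
noncomputable def triangleSeries (f : ℕ → ℕ → ℂ) : XSeries :=
  mk fun n => ∑ i ∈ Finset.range (n + 1), Polynomial.C (f n i) * Polynomial.X ^ i

/-- The generating function of the walks which start at the points `(i, 0)`. -/
noncomputable def sectorA (c : ℕ) (s : ℂ) : XSeries :=
  triangleSeries fun n i => sectorCount c s n i 0

/-- The generating function of the walks which start at the points `(0, j)`. -/
noncomputable def sectorB (c : ℕ) (s : ℂ) : XSeries :=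
  triangleSeries fun n j => sectorCount c s n 0 j

/-- The generating function of the walks which start at the points `(0, m + j)`, by `j`. -/
noncomputable def sectorTail (c : ℕ) (s : ℂ) (m : ℕ) : XSeries :=
  triangleSeries fun n j => sectorCount c s n 0 (j + m)

/-- The generating function of the walks which start at the point `(0, j)`. -/
noncomputable def sectorPoint (c : ℕ) (s : ℂ) (j : ℕ) : ℂ⟦X⟧ :=
  mk fun n => sectorCount c s n 0 j

lemma coeff_coeff_triangleSeries {f : ℕ → ℕ → ℂ} (hf : ∀ n i, n < i → f n i = 0) (n i : ℕ) :
    (coeff n (triangleSeries f)).coeff i = f n i := by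
  rw [triangleSeries, coeff_mk, Polynomial.finsetSum_coeff]
  simp only [Polynomial.coeff_C_mul_X_pow, Finset.sum_ite_eq, Finset.mem_range]
  split_ifs with h
  · rfl
  · exact (hf _ _ (by omega)).symm

lemma atZero_sectorA (hc : c ≤ 1) : atZero (sectorA c s) = sectorPoint c s 0 := by
  ext n
  rw [coeff_atZero, sectorA,
    coeff_coeff_triangleSeries fun n i h => sectorCount_eq_zero s hc (by omega), sectorPoint,
    coeff_mk]

lemma sectorTail_eq (hc : c ≤ 1) (m : ℕ) :
    sectorTail c s m = tSeries (sectorPoint c s m) + xVar * sectorTail c s (m + 1) := by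
  have h : ∀ m : ℕ, ∀ n i, n < i → sectorCount c s n 0 (i + m) = 0 :=
    fun m n i h => sectorCount_eq_zero s hc (by omega)
  ext n i
  rw [map_add, tSeries, coeff_map, xVar, coeff_C_mul, sectorTail, sectorTail, Polynomial.coeff_add,
    coeff_coeff_triangleSeries (h m), sectorPoint, coeff_mk]
  cases i with
  | zero => simp
  | succ i =>
    rw [Polynomial.coeff_X_mul, coeff_coeff_triangleSeries (h (m + 1)), Polynomial.coeff_C_succ,
      zero_add]
    congr 1
    omega

lemma sectorTail_zero : sectorTail c s 0 = sectorB c s := rfl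

section Recursion

variable {R : Type*} [CommRing R] [Algebra ℂ R]

lemma sum_range_eq_of_eq_zero {R : Type*} [CommRing R] {f : ℕ → R} {m M : ℕ}
    (h : m ≤ M) (hf : ∀ i, m ≤ i → f i = 0) :
    ∑ i ∈ Finset.range M, f i = ∑ i ∈ Finset.range m, f i := by
  symm
  exact Finset.sum_subset (Finset.range_subset_range.2 h) fun i _ hi => hf i (by simpa using hi)

lemma aeval_coeff_triangleSeries {f : ℕ → ℕ → ℂ} (hf : ∀ n i, n < i → f n i = 0) (a : R)
    {n M : ℕ} (h : n < M) : Polynomial.aeval a (coeff n (triangleSeries f))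
      = ∑ i ∈ Finset.range M, algebraMap ℂ R (f n i) * a ^ i := by
  rw [triangleSeries, coeff_mk, map_sum, sum_range_eq_of_eq_zero (show n + 1 ≤ M by omega)]
  · simp
  · intro i hi
    rw [hf n i hi, map_zero, zero_mul]

/-- The polynomial in two variables, evaluated at `(a, b)`, that enumerates the walks of length `n`
by their starting point. -/
noncomputable def sectorSum (c : ℕ) (s : ℂ) (a b : R) (n : ℕ) : R :=
  ∑ i ∈ Finset.range (n + 1), ∑ j ∈ Finset.range (n + 1),
    algebraMap ℂ R (sectorCount c s n i j) * a ^ i * b ^ j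

lemma sectorSum_eq (hc : c ≤ 1) (a b : R) {n M : ℕ} (h : n < M) :
    sectorSum c s a b n = ∑ i ∈ Finset.range M, ∑ j ∈ Finset.range M,
      algebraMap ℂ R (sectorCount c s n i j) * a ^ i * b ^ j := by
  have h0 : ∀ i j, n < i + j → algebraMap ℂ R (sectorCount c s n i j) * a ^ i * b ^ j = 0 := by
    intro i j hij
    rw [sectorCount_eq_zero s hc hij, map_zero, zero_mul, zero_mul]
  rw [sectorSum, sum_range_eq_of_eq_zero (show n + 1 ≤ M by omega)]
  · refine Finset.sum_congr rfl fun i _ => ?_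
    exact (sum_range_eq_of_eq_zero (by omega) fun j hj => h0 _ _ (by omega)).symm
  · exact fun i hi => Finset.sum_eq_zero fun j _ => h0 _ _ (by omega)

lemma mul_sectorSum_succ (hc : c ≤ 1) (a b : R) (n : ℕ) :
    a * b * sectorSum c s a b (n + 1) = a * b * (a + b) * sectorSum c s a b n
      + (sectorSum c s a b n - Polynomial.aeval a (coeff n (sectorA c s))
        - Polynomial.aeval b (coeff n (sectorB c s))
        + algebraMap ℂ R (coeff n (sectorPoint c s 0)))
      + algebraMap ℂ R s * (a * b) * b ^ c * Polynomial.aeval b (coeff n (sectorA c s))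
      + algebraMap ℂ R s⁻¹ * (a * b) * Polynomial.aeval a (coeff n (sectorTail c s (1 + c))) := by
  set H := sectorCount c s n with hH
  have hz : ∀ i j, n < i + j → H i j = 0 := fun i j h => sectorCount_eq_zero s hc h
  set M := n + 3 with hM
  have h1 : a * b * sectorSum c s a b (n + 1) = ∑ i ∈ Finset.range M, ∑ j ∈ Finset.range M,
      (algebraMap ℂ R (if i = 0 then (if c ≤ j then s * H (j - c) 0 else 0) else H (i - 1) j)
          * a ^ (i + 1) * b ^ (j + 1)
        + algebraMap ℂ R (if j = 0 then s⁻¹ * H 0 (i + 1 + c) else H i (j - 1))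
          * a ^ (i + 1) * b ^ (j + 1)
        + algebraMap ℂ R (H (i + 1) (j + 1)) * a ^ (i + 1) * b ^ (j + 1)) := by
    rw [sectorSum_eq s hc a b (show n + 1 < M by omega), Finset.mul_sum]
    refine Finset.sum_congr rfl fun i _ => ?_
    rw [Finset.mul_sum]
    refine Finset.sum_congr rfl fun j _ => ?_
    rw [sectorCount, map_add, map_add]
    ring
  have hF : ∀ N, n < N → sectorSum c s a b n = ∑ i ∈ Finset.range N, ∑ j ∈ Finset.range N,
      algebraMap ℂ R (H i j) * a ^ i * b ^ j := fun N hN => sectorSum_eq s hc a b hN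
  have h2 : ∑ i ∈ Finset.range M, ∑ j ∈ Finset.range M,
      algebraMap ℂ R (H (i + 1) (j + 1)) * a ^ (i + 1) * b ^ (j + 1)
      = sectorSum c s a b n - Polynomial.aeval a (coeff n (sectorA c s))
        - Polynomial.aeval b (coeff n (sectorB c s))
        + algebraMap ℂ R (coeff n (sectorPoint c s 0)) := by
    rw [hF (M + 1) (by omega), sectorA, sectorB,
      aeval_coeff_triangleSeries (fun n i h => sectorCount_eq_zero s hc (by omega)) a
        (show n < M + 1 by omega),
      aeval_coeff_triangleSeries (fun n i h => sectorCount_eq_zero s hc (by omega)) b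
        (show n < M + 1 by omega), sectorPoint, coeff_mk]
    simp only [Finset.sum_range_succ' _ M, Finset.sum_add_distrib, ← hH, pow_zero, mul_one]
    abel
  have h3 : ∑ i ∈ Finset.range M, ∑ j ∈ Finset.range M,
      algebraMap ℂ R (if i = 0 then (if c ≤ j then s * H (j - c) 0 else 0) else H (i - 1) j)
          * a ^ (i + 1) * b ^ (j + 1)
      = a * b * a * sectorSum c s a b n
        + algebraMap ℂ R s * (a * b) * b ^ c * Polynomial.aeval b (coeff n (sectorA c s)) := by
    rw [sectorA, aeval_coeff_triangleSeries (fun n i h => sectorCount_eq_zero s hc (by omega)) b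
        (show n < n + 3 - c by omega), hF (n + 2) (by omega), hM, Finset.sum_range_succ']
    congr 1
    · rw [Finset.mul_sum]
      refine Finset.sum_congr rfl fun i _ => ?_
      rw [Finset.sum_range_succ, if_neg (Nat.succ_ne_zero i), hz _ _ (by omega), Finset.mul_sum,
        map_zero, zero_mul, zero_mul, add_zero]
      refine Finset.sum_congr rfl fun j _ => ?_
      rw [if_neg (Nat.succ_ne_zero i), Nat.add_sub_cancel]
      ring
    · conv_lhs => rw [show n + 3 = c + (n + 3 - c) by omega, Finset.sum_range_add]
      rw [Finset.sum_eq_zero, zero_add, Finset.mul_sum]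
      · refine Finset.sum_congr rfl fun j _ => ?_
        rw [if_pos rfl, if_pos (by omega), Nat.add_sub_cancel_left, map_mul]
        ring
      · intro j hj
        rw [if_pos rfl, if_neg (by simpa using hj), map_zero, zero_mul, zero_mul]
  have h4 : ∑ i ∈ Finset.range M, ∑ j ∈ Finset.range M,
      algebraMap ℂ R (if j = 0 then s⁻¹ * H 0 (i + 1 + c) else H i (j - 1))
          * a ^ (i + 1) * b ^ (j + 1)
      = a * b * b * sectorSum c s a b n
        + algebraMap ℂ R s⁻¹ * (a * b)
          * Polynomial.aeval a (coeff n (sectorTail c s (1 + c))) := by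
    rw [sectorTail, aeval_coeff_triangleSeries
        (fun n i h => sectorCount_eq_zero s hc (by omega)) a (show n < n + 3 by omega),
        hF (n + 2) (by omega), hM, Finset.sum_comm, Finset.sum_range_succ']
    congr 1
    · rw [Finset.sum_comm, Finset.sum_range_succ, Finset.mul_sum]
      rw [Finset.sum_eq_zero (s := Finset.range (n + 2)) (f := fun j => algebraMap ℂ R _ * _ * _),
        add_zero]
      · refine Finset.sum_congr rfl fun i _ => ?_
        rw [Finset.mul_sum]
        refine Finset.sum_congr rfl fun j _ => ?_
        rw [if_neg (Nat.succ_ne_zero j), Nat.add_sub_cancel]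
        ring
      · intro j _
        rw [if_neg (Nat.succ_ne_zero j), hz _ _ (by omega), map_zero, zero_mul, zero_mul]
    · rw [Finset.mul_sum]
      refine Finset.sum_congr rfl fun i _ => ?_
      rw [if_pos rfl, map_mul, ← hH, add_assoc i 1 c]
      ring
  rw [h1]
  simp only [Finset.sum_add_distrib]
  rw [h2, h3, h4]
  ring

end Recursion

/-- The functional equation for the walks, evaluated at a point where the kernel vanishes. -/
lemma kernel_equation (hc : c ≤ 1) {S : Type*} [CommRing S] [Algebra ℂ S] {a b τ : S⟦X⟧}
    (hτ : constantCoeff τ = 0) (hker : τ * (1 + a ^ 2 * b + a * b ^ 2) = a * b) :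
    a * b - τ * substSeries a τ hτ (sectorA c s) - τ * substSeries b τ hτ (sectorB c s)
      + τ * substSeries a τ hτ (tSeries (sectorPoint c s 0))
      + τ * algebraMap ℂ S⟦X⟧ s * (a * b) * b ^ c * substSeries b τ hτ (sectorA c s)
      + τ * algebraMap ℂ S⟦X⟧ s⁻¹ * (a * b)
        * substSeries a τ hτ (sectorTail c s (1 + c)) = 0 := by
  set Φ : S⟦X⟧⟦X⟧ := mk fun n => sectorSum c s a b n with hΦ
  set σ : S⟦X⟧ → XSeries → S⟦X⟧⟦X⟧ :=
    fun a F => PowerSeries.map (Polynomial.aeval a : Polynomial ℂ →ₐ[ℂ] S⟦X⟧) F with hσ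
  have key : C (a * b) * Φ = C (a * b) + X * (C (a * b * (a + b)) * Φ
      + (Φ - σ a (sectorA c s) - σ b (sectorB c s) + σ a (tSeries (sectorPoint c s 0)))
      + C (algebraMap ℂ S⟦X⟧ s * (a * b) * b ^ c) * σ b (sectorA c s)
      + C (algebraMap ℂ S⟦X⟧ s⁻¹ * (a * b)) * σ a (sectorTail c s (1 + c))) := by
    ext1 n
    cases n with
    | zero =>
      rw [map_add, coeff_zero_X_mul, coeff_C_mul, coeff_zero_C, hΦ, coeff_mk, sectorSum]
      simp [sectorCount]
    | succ n =>
      rw [map_add, coeff_succ_X_mul, coeff_C_mul, coeff_C, if_neg (Nat.succ_ne_zero n), zero_add,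
        hΦ, coeff_mk, mul_sectorSum_succ s hc]
      simp only [map_add, map_sub, coeff_C_mul, coeff_mk, hσ, coeff_map, tSeries, RingHom.coe_coe,
        Polynomial.aeval_C]
  have h := congrArg (evalSeries τ hτ) key
  have e : ∀ a F, evalSeries τ hτ (σ a F) = substSeries a τ hτ F := fun _ _ => rfl
  simp only [map_add, map_sub, map_mul (evalSeries τ hτ), evalSeries_C, evalSeries_X, e] at h
  linear_combination -h - evalSeries τ hτ Φ * hker

end Sector

/-! ### Kreweras walks and sectors -/

section Walks

open Finset

lemma zeta3_eq : zeta3 = -(1 / 2) + (Real.sqrt 3 / 2 : ℝ) * Complex.I := by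
  rw [zeta3, show (2 * Real.pi * Complex.I / 3 : ℂ)
      = ((Real.pi - Real.pi / 3 : ℝ) : ℂ) * Complex.I by push_cast; ring,
    Complex.exp_mul_I, ← Complex.ofReal_cos, ← Complex.ofReal_sin,
    Real.cos_pi_sub, Real.sin_pi_sub, Real.cos_pi_div_three, Real.sin_pi_div_three]
  push_cast
  ring

lemma zeta3_re : zeta3.re = -(1 / 2) := by
  rw [zeta3_eq]; simp

lemma zeta3_im : zeta3.im = Real.sqrt 3 / 2 := by
  rw [zeta3_eq]; simp

lemma zeta3_sq : zeta3 ^ 2 = -1 - zeta3 := by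
  apply Complex.ext
  · rw [pow_two, Complex.mul_re, Complex.sub_re, zeta3_re, zeta3_im]
    norm_num
    nlinarith [Real.mul_self_sqrt (show (0 : ℝ) ≤ 3 by norm_num)]
  · rw [pow_two, Complex.mul_im, Complex.sub_im, zeta3_re, zeta3_im]
    norm_num
    ring

lemma zeta3_pow_three : zeta3 ^ 3 = 1 := by
  linear_combination (zeta3 - 1) * zeta3_sq

lemma zeta3_ne_zero : zeta3 ≠ 0 := Complex.exp_ne_zero _

lemma arg_zeta3 : zeta3.arg = 2 * Real.pi / 3 := by
  have h := Real.pi_pos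
  rw [zeta3, show (2 * Real.pi * Complex.I / 3 : ℂ) = ((2 * Real.pi / 3 : ℝ) : ℂ) * Complex.I by
    push_cast; ring, Complex.arg_exp_mul_I, toIocMod_eq_self]
  constructor <;> linarith

/-- The weight `s ^ k` of the angle `2 π k / 3`; other angles have weight zero. -/
noncomputable def angleWeight (s : ℂ) (θ : ℝ) : ℂ :=
  ∑ᶠ k : ℤ, if θ = 2 * Real.pi * k / 3 then s ^ k else 0

lemma eq_of_angle_eq {k l : ℤ} (h : 2 * Real.pi * (k : ℝ) / 3 = 2 * Real.pi * l / 3) : k = l := by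
  have hpi := Real.pi_ne_zero
  field_simp at h
  exact_mod_cast h

lemma angleWeight_zero (s : ℂ) : angleWeight s 0 = 1 := by
  rw [angleWeight, finsum_eq_single _ 0]
  · simp
  · intro k hk
    rw [if_neg]
    intro h
    apply hk
    exact (eq_of_angle_eq (k := 0) (l := k) (by simpa using h)).symm

lemma angleWeight_add {s : ℂ} (hs : s ≠ 0) (θ : ℝ) (m : ℤ) :
    angleWeight s (θ + 2 * Real.pi * m / 3) = s ^ m * angleWeight s θ := by
  rw [angleWeight, angleWeight, ← finsum_comp_equiv (Equiv.addRight m), ← smul_eq_mul (s ^ m),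
    smul_finsum]
  refine finsum_congr fun k => ?_
  have h1 : θ + 2 * Real.pi * m / 3 = 2 * Real.pi * ((Equiv.addRight m k : ℤ) : ℝ) / 3
      ↔ θ = 2 * Real.pi * k / 3 := by
    rw [Equiv.coe_addRight]
    push_cast
    constructor <;> intro h <;> linarith
  rw [if_congr h1 rfl rfl, smul_eq_mul, mul_ite, mul_zero, Equiv.coe_addRight, zpow_add₀ hs,
    mul_comm (s ^ k)]

lemma KWalk.vertex_zero (p a : ℂ) {n : ℕ} (w : KWalk n) : w.vertex p a 0 = p := by
  simp [KWalk.vertex]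

lemma KWalk.vertex_cons (p a : ℂ) {n : ℕ} (l : Fin 3) (w : KWalk n) (i : ℕ) :
    KWalk.vertex p a (n := n + 1) (Fin.cons l w) (i + 1)
      = w.vertex (p + a * zeta3 ^ (l : ℕ)) a i := by
  rw [KWalk.vertex, KWalk.vertex, sum_filter, sum_filter, Fin.sum_univ_succ]
  simp [add_assoc]

lemma KWalk.windingAngle_cons (p a : ℂ) {n : ℕ} (l : Fin 3) (w : KWalk n) :
    KWalk.windingAngle p a (n := n + 1) (Fin.cons l w)
      = Complex.arg ((p + a * zeta3 ^ (l : ℕ)) / p)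
        + w.windingAngle (p + a * zeta3 ^ (l : ℕ)) a := by
  rw [KWalk.windingAngle, sum_range_succ', KWalk.vertex_cons, KWalk.vertex_zero, KWalk.vertex_zero,
    add_comm]
  congr 1
  refine sum_congr rfl fun i _ => ?_
  rw [KWalk.vertex_cons, KWalk.vertex_cons]

open Classical in
/-- The sum of the weights of the walks from `v` to `T` which avoid `0`, where the winding angle is
measured from `φ`. -/
noncomputable def walkSum (a : ℂ) (T : Set ℂ) (s : ℂ) (n : ℕ) (v : ℂ) (φ : ℝ) : ℂ :=
  ∑ w : KWalk n, if (∀ i ≤ n, w.vertex v a i ≠ 0) ∧ w.vertex v a n ∈ T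
    then angleWeight s (w.windingAngle v a - φ) else 0

lemma coeff_krewerasSeries (p a : ℂ) (T : Set ℂ) (s : ℂ) (n : ℕ) :
    PowerSeries.coeff n (krewerasSeries p a T s) = walkSum a T s n p 0 := by
  classical
  rw [krewerasSeries, PowerSeries.coeff_mk, walkSum]
  have h : ∀ k : ℤ, ((krewerasWalks p a T n k).ncard : ℂ) * s ^ k
      = ∑ w : KWalk n, if (∀ i ≤ n, w.vertex p a i ≠ 0) ∧ w.vertex p a n ∈ T then
        (if w.windingAngle p a = 2 * Real.pi * k / 3 then s ^ k else 0) else 0 := by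
    intro k
    rw [Set.ncard_eq_toFinset_card _ (Set.toFinite _), ← nsmul_eq_mul, ← sum_const]
    simp only [← ite_and]
    rw [← sum_filter]
    refine sum_congr ?_ fun _ _ => rfl
    ext w
    simp [krewerasWalks, and_assoc]
  rw [finsum_congr h, finsum_sum_comm]
  · refine sum_congr rfl fun w _ => ?_
    split_ifs with hw
    · rw [sub_zero, angleWeight]
    · exact finsum_zero
  · intro w _
    refine Set.Finite.subset (s := {k : ℤ | w.windingAngle p a = 2 * Real.pi * k / 3}) ?_ ?_
    · exact Set.Subsingleton.finite fun k hk l hl => eq_of_angle_eq (hk.symm.trans hl)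
    · intro k hk
      by_contra hne
      apply hk
      have : ¬ w.windingAngle p a = 2 * Real.pi * k / 3 := hne
      simp [this]

lemma walkSum_zero {a : ℂ} {T : Set ℂ} {s v : ℂ} {φ : ℝ} [Decidable (v ≠ 0 ∧ v ∈ T)] :
    walkSum a T s 0 v φ = if v ≠ 0 ∧ v ∈ T then angleWeight s (-φ) else 0 := by
  rw [walkSum, Fintype.sum_unique]
  simp [KWalk.vertex_zero, KWalk.windingAngle]

lemma walkSum_start_zero {a : ℂ} {T : Set ℂ} {s : ℂ} {n : ℕ} {φ : ℝ} :
    walkSum a T s n 0 φ = 0 := by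
  rw [walkSum]
  refine sum_eq_zero fun w _ => if_neg fun h => h.1 0 (Nat.zero_le n) ?_
  rw [KWalk.vertex_zero]

lemma walkSum_succ {a : ℂ} {T : Set ℂ} {s : ℂ} {n : ℕ} {v : ℂ} {φ : ℝ} (hv : v ≠ 0) :
    walkSum a T s (n + 1) v φ = ∑ l : Fin 3, walkSum a T s n (v + a * zeta3 ^ (l : ℕ))
      (φ - Complex.arg ((v + a * zeta3 ^ (l : ℕ)) / v)) := by
  classical
  simp only [walkSum]
  rw [← Finset.sum_product', ← (Fin.consEquiv fun _ => Fin 3).sum_comp]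
  refine sum_congr rfl fun ⟨l, (w : KWalk n)⟩ _ => ?_
  have h0 : (Fin.consEquiv fun _ => Fin 3) (l, w) = (Fin.cons l w : KWalk (n + 1)) := rfl
  rw [h0, KWalk.vertex_cons, KWalk.windingAngle_cons]
  have h1 : (∀ i ≤ n + 1, KWalk.vertex v a (n := n + 1) (Fin.cons l w) i ≠ 0)
      ↔ ∀ i ≤ n, KWalk.vertex (v + a * zeta3 ^ (l : ℕ)) a w i ≠ 0 := by
    constructor
    · intro h i hi
      rw [← KWalk.vertex_cons]
      exact h _ (by omega)
    · intro h i hi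
      cases i with
      | zero => rwa [KWalk.vertex_zero]
      | succ i =>
        rw [KWalk.vertex_cons]
        exact h _ (by omega)
  rw [if_congr (and_congr_left' h1) rfl rfl]
  congr 2
  ring

/-- Three sectors around the origin, obtained from each other by rotations through `2 π / 3`, cover
a Kreweras lattice with steps `d * a * zeta3 ^ l`. The points of one sector are `d * N i j`, and the
steps from its points lead to points of the same or of an adjacent sector, as in `sectorCount`, or
to the origin. -/
structure IsSectorChart (c : ℕ) (d a : ℂ) (N : ℕ → ℕ → ℂ) : Prop where
  scale_ne_zero : d ≠ 0
  re_pos : ∀ i j, 0 < (N i j).re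
  im_nonneg : ∀ j, c ≤ j → 0 ≤ (N 0 j).im
  im_nonpos : ∀ i, (N i 0).im ≤ 0
  step_left : ∀ i j, N (i + 1) j + a = N i j
  step_next : ∀ j, N 0 (c + j) + a = zeta3 * N j 0
  step_origin : ∀ j < c, N 0 j + a = 0
  step_down : ∀ i j, N i (j + 1) + a * zeta3 = N i j
  step_previous : ∀ i, N i 0 + a * zeta3 = zeta3 ^ 2 * N 0 (i + 1 + c)
  step_diagonal : ∀ i j, N i j + a * zeta3 ^ 2 = N (i + 1) (j + 1)
  apex : ∀ i j, N i j = N 0 0 ∨ N i j = N 0 0 * zeta3 ∨ N i j = N 0 0 * zeta3 ^ 2 → i = 0 ∧ j = 0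

lemma arg_rotate_div {x y : ℂ} (hx : 0 < x.re) (hy : 0 < y.re) {ζ : ℂ} {m : ℤ}
    (hζ : (ζ.arg : Real.Angle) = ((2 * Real.pi * m / 3 : ℝ) : Real.Angle)) (h0 : ζ ≠ 0)
    (h1 : -Real.pi < y.arg - x.arg + 2 * Real.pi * m / 3)
    (h2 : y.arg - x.arg + 2 * Real.pi * m / 3 ≤ Real.pi) :
    (ζ * y / x).arg = y.arg - x.arg + 2 * Real.pi * m / 3 := by
  have hx0 : x ≠ 0 := by rintro rfl; simp at hx
  have hy0 : y ≠ 0 := by rintro rfl; simp at hy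
  rw [← Complex.arg_coe_angle_toReal_eq_arg, Complex.arg_div_coe_angle (mul_ne_zero h0 hy0) hx0,
    Complex.arg_mul_coe_angle h0 hy0, hζ, ← Real.Angle.coe_add, ← Real.Angle.coe_sub,
    Real.Angle.toReal_coe_eq_self_iff.2]
  · ring
  · constructor <;> linarith

lemma sum_cube_roots {u : ℂ} (hu : u = 1 ∨ u = zeta3 ∨ u = zeta3 ^ 2) (f : ℂ → ℂ) :
    ∑ l : Fin 3, f (zeta3 ^ (l : ℕ)) = f u + f (u * zeta3) + f (u * zeta3 ^ 2) := by
  have h3 := zeta3_pow_three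
  have h1 : zeta3 * zeta3 ^ 2 = 1 := by rw [← h3]; ring
  have h2 : zeta3 ^ 2 * zeta3 ^ 2 = zeta3 := by linear_combination zeta3 * h3
  rw [Fin.sum_univ_three]
  rcases hu with rfl | rfl | rfl
  · simp
  · rw [h1, ← pow_two]
    simp
    ring
  · rw [mul_comm _ zeta3, h1, h2]
    simp
    ring

/-- The weighted count of Kreweras walks by winding angle, in sector coordinates. -/
theorem IsSectorChart.walkSum_eq {c : ℕ} {d a : ℂ} {N : ℕ → ℕ → ℂ} (hN : IsSectorChart c d a N)
    {s : ℂ} (hs : s ≠ 0) {T : Set ℂ}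
    (hT : T = {d * N 0 0, d * N 0 0 * zeta3, d * N 0 0 * zeta3 ^ 2}) (n i j : ℕ) {u : ℂ}
    (hu : u = 1 ∨ u = zeta3 ∨ u = zeta3 ^ 2) :
    walkSum (d * a) T s n (d * u * N i j) ((N 0 0).arg - (N i j).arg) = sectorCount c s n i j := by
  classical
  have hd := hN.scale_ne_zero
  have h3 := zeta3_pow_three
  have hz0 := zeta3_ne_zero
  have hNne : ∀ i j, N i j ≠ 0 := fun i j h => by
    have := hN.re_pos i j
    simp [h] at this
  have hne : ∀ {u : ℂ}, (u = 1 ∨ u = zeta3 ∨ u = zeta3 ^ 2) → ∀ i j, d * u * N i j ≠ 0 := by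
    intro u hu i j
    refine mul_ne_zero (mul_ne_zero hd ?_) (hNne i j)
    rcases hu with rfl | rfl | rfl
    · exact one_ne_zero
    · exact hz0
    · exact pow_ne_zero _ hz0
  have hmul : ∀ {u : ℂ}, (u = 1 ∨ u = zeta3 ∨ u = zeta3 ^ 2) →
      (u * zeta3 = 1 ∨ u * zeta3 = zeta3 ∨ u * zeta3 = zeta3 ^ 2) := by
    rintro u (rfl | rfl | rfl)
    · right; left; ring
    · right; right; ring
    · left; rw [← h3]; ring
  have hmul2 : ∀ {u : ℂ}, (u = 1 ∨ u = zeta3 ∨ u = zeta3 ^ 2) →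
      (u * zeta3 ^ 2 = 1 ∨ u * zeta3 ^ 2 = zeta3 ∨ u * zeta3 ^ 2 = zeta3 ^ 2) := by
    intro u hu
    have := hmul (hmul hu)
    rwa [mul_assoc, ← pow_two] at this
  have ha := fun i j => abs_lt.1 (Complex.abs_arg_lt_pi_div_two_iff.2 (Or.inl (hN.re_pos i j)))
  induction n generalizing i j u with
  | zero =>
    rw [walkSum_zero, sectorCount]
    by_cases hij : i = 0 ∧ j = 0
    · obtain ⟨rfl, rfl⟩ := hij
      rw [if_pos, if_pos ⟨rfl, rfl⟩, sub_self, neg_zero, angleWeight_zero]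
      refine ⟨hne hu 0 0, ?_⟩
      rw [hT]
      rcases hu with rfl | rfl | rfl
      · left; ring
      · right; left; ring
      · right; right; exact Set.mem_singleton_iff.2 (by ring)
    · rw [if_neg hij, if_neg]
      rintro ⟨-, h⟩
      apply hij
      apply hN.apex
      rw [hT] at h
      have h' : d * u * N i j = d * N 0 0 ∨ d * u * N i j = d * N 0 0 * zeta3 ∨
        d * u * N i j = d * N 0 0 * zeta3 ^ 2 := h
      have hc : ∀ ζ : ℂ, d * u * N i j = d * N 0 0 * ζ → u * N i j = N 0 0 * ζ := fun ζ h =>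
        mul_left_cancel₀ hd (by linear_combination h)
      have h'' : u * N i j = N 0 0 * 1 ∨ u * N i j = N 0 0 * zeta3 ∨
        u * N i j = N 0 0 * zeta3 ^ 2 :=
        h'.imp (fun h => hc _ (by rw [h, mul_one])) (Or.imp (hc _) (hc _))
      have hcan : ∀ x y : ℂ, zeta3 * x = zeta3 * y → x = y := fun x y h => mul_left_cancel₀ hz0 h
      rcases hu with rfl | rfl | rfl <;> rcases h'' with h | h | h
      · left; linear_combination h
      · right; left; linear_combination h
      · right; right; linear_combination h
      · right; right; linear_combination zeta3 ^ 2 * h - N i j * h3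
      · left; linear_combination zeta3 ^ 2 * h + (N 0 0 - N i j) * h3
      · right; left; linear_combination zeta3 ^ 2 * h + (N 0 0 * zeta3 - N i j) * h3
      · right; left; linear_combination zeta3 * h - N i j * h3
      · right; right; linear_combination zeta3 * h - N i j * h3
      · left; linear_combination zeta3 * h + (N 0 0 - N i j) * h3
  | succ n ih =>
    -- a step to the point `(i', j')` of the sector which is `m` places ahead
    have hstep : ∀ {i j i' j' : ℕ} {u ζ e : ℂ} {m : ℤ}, (u = 1 ∨ u = zeta3 ∨ u = zeta3 ^ 2) →
        (u * ζ = 1 ∨ u * ζ = zeta3 ∨ u * ζ = zeta3 ^ 2) →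
        N i j + e = ζ * N i' j' →
        (ζ.arg : Real.Angle) = ((2 * Real.pi * m / 3 : ℝ) : Real.Angle) →
        -Real.pi < (N i' j').arg - (N i j).arg + 2 * Real.pi * m / 3 →
        (N i' j').arg - (N i j).arg + 2 * Real.pi * m / 3 ≤ Real.pi →
        walkSum (d * a) T s n (d * u * N i j + d * (u * e))
          ((N 0 0).arg - (N i j).arg
            - ((d * u * N i j + d * (u * e)) / (d * u * N i j)).arg)
          = s ^ m * sectorCount c s n i' j' := by
      intro i j i' j' u ζ e m hu huζ he hζ hl hr
      have hdu : d * u ≠ 0 := left_ne_zero_of_mul (hne hu 0 0)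
      have hζ0 : ζ ≠ 0 := by
        rintro rfl
        have := hne huζ 0 0
        simp at this
      have h1 : d * u * N i j + d * (u * e) = d * (u * ζ) * N i' j' := by
        linear_combination d * u * he
      have h2 : d * (u * ζ) * N i' j' / (d * u * N i j) = ζ * N i' j' / N i j := by
        have := hNne i j
        have h5 := right_ne_zero_of_mul hdu
        field_simp
      rw [h1, h2, arg_rotate_div (hN.re_pos _ _) (hN.re_pos _ _) hζ hζ0 hl hr,
        ← ih i' j' huζ, walkSum, walkSum, mul_sum]
      refine sum_congr rfl fun w _ => ?_
      rw [mul_ite, mul_zero, ← angleWeight_add hs]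
      congr 2
      ring
    have hpi := Real.pi_pos
    have hone : ((1 : ℂ).arg : Real.Angle) = ((2 * Real.pi * (0 : ℤ) / 3 : ℝ) : Real.Angle) := by
      simp
    have hzeta : (zeta3.arg : Real.Angle) = ((2 * Real.pi * (1 : ℤ) / 3 : ℝ) : Real.Angle) := by
      rw [arg_zeta3]; simp
    have hzeta2 : ((zeta3 ^ 2).arg : Real.Angle)
        = ((2 * Real.pi * (-1 : ℤ) / 3 : ℝ) : Real.Angle) := by
      have : zeta3 ^ 2 = zeta3⁻¹ := eq_inv_of_mul_eq_one_left (by rw [← h3]; ring)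
      rw [this, Complex.arg_inv_coe_angle, hzeta, ← Real.Angle.coe_neg]
      congr 1
      push_cast
      ring
    have hsame : ∀ {i j i' j' : ℕ} {u e : ℂ}, (u = 1 ∨ u = zeta3 ∨ u = zeta3 ^ 2) →
        N i j + e = N i' j' →
        walkSum (d * a) T s n (d * u * N i j + d * (u * e))
          ((N 0 0).arg - (N i j).arg
            - ((d * u * N i j + d * (u * e)) / (d * u * N i j)).arg)
          = sectorCount c s n i' j' := by
      intro i j i' j' u e hu he
      have h1 := ha i j
      have h2 := ha i' j'
      rw [hstep hu (ζ := 1) (m := 0) (by rwa [mul_one]) (by rw [he, one_mul]) hone, zpow_zero,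
        one_mul]
      · simp only [Int.cast_zero]; linarith
      · simp only [Int.cast_zero]; linarith
    rw [walkSum_succ (hne hu i j), sum_cube_roots hu fun ζ => walkSum (d * a) T s n
      (d * u * N i j + d * a * ζ) ((N 0 0).arg - (N i j).arg
        - ((d * u * N i j + d * a * ζ) / (d * u * N i j)).arg), sectorCount]
    have e0 : d * a * u = d * (u * a) := by ring
    have e1 : d * a * (u * zeta3) = d * (u * (a * zeta3)) := by ring
    have e2 : d * a * (u * zeta3 ^ 2) = d * (u * (a * zeta3 ^ 2)) := by ring
    rw [e0, e1, e2]
    congr 1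
    · congr 1
      · cases i with
        | zero =>
          rw [if_pos rfl]
          split_ifs with hj
          · obtain ⟨j, rfl⟩ := Nat.exists_eq_add_of_le hj
            have h1 := ha 0 (c + j)
            have h2 := ha j 0
            have h4 := Complex.arg_nonneg_iff.2 (hN.im_nonneg (c + j) hj)
            have h5 : (N j 0).arg ≤ 0 := by
              rcases (hN.im_nonpos j).lt_or_eq with h | h
              · exact (Complex.arg_neg_iff.2 h).le
              · exact (Complex.arg_eq_zero_iff.2 ⟨(hN.re_pos j 0).le, h⟩).le
            rw [hstep hu (m := 1) (hmul hu) (hN.step_next j) hzeta, zpow_one,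
              Nat.add_sub_cancel_left]
            · push_cast; linarith
            · push_cast; linarith
          · rw [show d * u * N 0 j + d * (u * a) = 0 by
              linear_combination d * u * hN.step_origin j (by omega), walkSum_start_zero]
        | succ i =>
          rw [if_neg (Nat.succ_ne_zero i), Nat.add_sub_cancel, hsame hu (hN.step_left i j)]
      · cases j with
        | zero =>
          rw [if_pos rfl]
          have h1 := ha i 0
          have h2 := ha 0 (i + 1 + c)
          have h4 := Complex.arg_nonneg_iff.2 (hN.im_nonneg (i + 1 + c) (by omega))
          have h5 : (N i 0).arg ≤ 0 := by
            rcases (hN.im_nonpos i).lt_or_eq with h | h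
            · exact (Complex.arg_neg_iff.2 h).le
            · exact (Complex.arg_eq_zero_iff.2 ⟨(hN.re_pos i 0).le, h⟩).le
          rw [hstep hu (m := -1) (hmul2 hu) (hN.step_previous i) hzeta2, zpow_neg_one]
          · push_cast; linarith
          · push_cast; linarith
        | succ j =>
          rw [if_neg (Nat.succ_ne_zero j), Nat.add_sub_cancel, hsame hu (hN.step_down i j)]
    · rw [hsame hu (hN.step_diagonal i j)]

lemma isSectorChart_cell : IsSectorChart 0 1 (zeta3 - 1)
    fun i j => 1 + i * (1 - zeta3) + j * (zeta3 - zeta3 ^ 2) := by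
  have hw := zeta3_sq
  have h3 : 0 < Real.sqrt 3 := Real.sqrt_pos.2 (by norm_num)
  have hre : ∀ i j : ℕ, (1 + i * (1 - zeta3) + j * (zeta3 - zeta3 ^ 2) : ℂ).re = 1 + 3 / 2 * i := by
    intro i j
    rw [hw]
    simp [zeta3_re]
    ring
  have him : ∀ i j : ℕ, (1 + i * (1 - zeta3) + j * (zeta3 - zeta3 ^ 2) : ℂ).im
      = Real.sqrt 3 / 2 * (2 * j - i) := by
    intro i j
    rw [hw]
    simp [zeta3_im]
    ring
  constructor
  · exact one_ne_zero
  · intro i j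
    rw [hre]
    positivity
  · intro j _
    rw [him]
    push_cast
    rw [sub_zero]
    positivity
  · intro i
    rw [him]
    have : (0 : ℝ) ≤ Real.sqrt 3 / 2 * i := by positivity
    push_cast
    linarith
  · intro i j
    push_cast
    ring
  · intro j
    push_cast
    ring
  · intro j hj
    omega
  · intro i j
    push_cast
    ring
  · intro i
    push_cast
    linear_combination (-(i + 1) * (1 - zeta3)) * zeta3_pow_three
  · intro i j
    push_cast
    linear_combination zeta3_pow_three
  · intro i j h
    have h1 : (1 + i * (1 - zeta3) + j * (zeta3 - zeta3 ^ 2) : ℂ) = 1 ∨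
        (1 + i * (1 - zeta3) + j * (zeta3 - zeta3 ^ 2) : ℂ) = zeta3 ∨
        (1 + i * (1 - zeta3) + j * (zeta3 - zeta3 ^ 2) : ℂ) = -1 - zeta3 := by
      simpa [hw] using h
    have hi0 : (0 : ℝ) ≤ i := by positivity
    rcases h1 with h | h | h
    · have h5 := congrArg Complex.re h
      have h6 := congrArg Complex.im h
      rw [hre, Complex.one_re] at h5
      have h7 : (i : ℝ) = 0 := by linarith
      rw [him, h7, sub_zero, Complex.one_im] at h6
      have h8 : (j : ℝ) = 0 := by
        rcases mul_eq_zero.1 h6 with h6 | h6 <;> linarith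
      exact_mod_cast And.intro h7 h8
    · have h5 := congrArg Complex.re h
      rw [hre, zeta3_re] at h5
      linarith
    · have h5 := congrArg Complex.re h
      rw [hre, Complex.sub_re, Complex.neg_re, Complex.one_re, zeta3_re] at h5
      linarith

lemma isSectorChart_vertex : IsSectorChart 1 (zeta3 ^ 2) zeta3
    fun i j => -(i + 1) * zeta3 - j * zeta3 ^ 2 := by
  have hw := zeta3_sq
  have h3 : 0 < Real.sqrt 3 := Real.sqrt_pos.2 (by norm_num)
  have hre : ∀ i j : ℕ, (-(i + 1) * zeta3 - j * zeta3 ^ 2 : ℂ).re = (i + 1 + j) / 2 := by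
    intro i j
    rw [hw]
    simp [zeta3_re]
    ring
  have him : ∀ i j : ℕ, (-(i + 1) * zeta3 - j * zeta3 ^ 2 : ℂ).im
      = Real.sqrt 3 / 2 * (j - (i + 1)) := by
    intro i j
    rw [hw]
    simp [zeta3_im]
    ring
  constructor
  · exact pow_ne_zero _ zeta3_ne_zero
  · intro i j
    rw [hre]
    positivity
  · intro j hj
    rw [him]
    have : (1 : ℝ) ≤ j := by exact_mod_cast hj
    push_cast
    refine mul_nonneg (by positivity) (by linarith)
  · intro i
    rw [him]
    have : (0 : ℝ) ≤ Real.sqrt 3 / 2 * (i + 1) := by positivity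
    push_cast
    linarith
  · intro i j
    push_cast
    ring
  · intro j
    push_cast
    ring
  · intro j hj
    obtain rfl : j = 0 := by omega
    push_cast
    ring
  · intro i j
    push_cast
    ring
  · intro i
    push_cast
    linear_combination (1 + (i + 2) * zeta3) * zeta3_pow_three + hw
  · intro i j
    push_cast
    linear_combination zeta3_pow_three + hw
  · intro i j h
    have h0 : -((0 : ℕ) + 1 : ℂ) * zeta3 - (0 : ℕ) * zeta3 ^ 2 = -zeta3 := by
      push_cast
      ring
    have h1 : ((i : ℝ) + 1 + j) / 2 = 1 / 2 ∨ ((i : ℝ) + 1 + j) / 2 < 0 := by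
      rw [← hre]
      simp only [h0] at h
      rcases h with h | h | h
      · left
        rw [h, Complex.neg_re, zeta3_re]
        norm_num
      · left
        rw [h, show -zeta3 * zeta3 = 1 + zeta3 by linear_combination -hw, Complex.add_re, zeta3_re,
          Complex.one_re]
        norm_num
      · right
        rw [h, show -zeta3 * zeta3 ^ 2 = -1 by linear_combination -zeta3_pow_three]
        norm_num
    have hi0 : (0 : ℝ) ≤ i := by positivity
    have hj0 : (0 : ℝ) ≤ j := by positivity
    have h2 : (i : ℝ) = 0 ∧ (j : ℝ) = 0 := by
      rcases h1 with h | h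
      · constructor <;> linarith
      · linarith
    exact_mod_cast h2

lemma cellSeries_eq {s : ℂ} (hs : s ≠ 0) :
    cellSeries s = sectorPoint 0 s 0 := by
  ext n
  have h := isSectorChart_cell.walkSum_eq hs rfl n 0 0 (Or.inl rfl)
  rw [cellSeries, coeff_krewerasSeries, sectorPoint, PowerSeries.coeff_mk, ← h]
  simp

lemma vertexSeries_eq {s : ℂ} (hs : s ≠ 0) :
    vertexSeries s = sectorPoint 1 s 0 := by
  ext n
  have h3 := zeta3_pow_three
  have h := isSectorChart_vertex.walkSum_eq hs rfl n 0 0 (Or.inl rfl)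
  rw [vertexSeries, coeff_krewerasSeries, sectorPoint, PowerSeries.coeff_mk, ← h]
  have e0 : zeta3 ^ 2 * (-((0 : ℕ) + 1 : ℂ) * zeta3 - (0 : ℕ) * zeta3 ^ 2) = -1 := by
    push_cast
    linear_combination -h3
  rw [mul_one, e0, sub_self, show zeta3 ^ 2 * zeta3 = 1 by linear_combination h3, neg_one_mul,
    neg_one_mul]

end Walks

/-! ### Functions on the kernel curve with a simple pole -/

section SimplePole

open PowerSeries

/-- The sum `y + z` of the other two coordinates on the kernel curve, expressed through `x`. -/
noncomputable def otherSum : XField := tF⁻¹ - xF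

/-- The product `y * z` of the other two coordinates on the kernel curve, expressed through `x`. -/
noncomputable def otherProd : XField := xF⁻¹

lemma xF_inv_eq : xF⁻¹ = tF * zF :=
  (eq_inv_of_mul_eq_one_left (by linear_combination xF_mul_tF_mul_zF)).symm

lemma tF_inv_eq : tF⁻¹ = zF * xF :=
  (eq_inv_of_mul_eq_one_left (by linear_combination xF_mul_tF_mul_zF)).symm

lemma onX_otherSum : onX otherSum = tF + zF := by
  rw [otherSum, map_sub, map_inv₀, onX_tF, onX_xF, kerT_inv]
  ring

lemma onY_otherSum : onY otherSum = zF + xF := by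
  rw [otherSum, map_sub, map_inv₀, onY_tF, onY_xF, kerT_inv]
  ring

lemma onX_otherProd : onX otherProd = tF * zF := by
  rw [otherProd, map_inv₀, onX_xF, xF_inv_eq]

lemma onY_otherProd : onY otherProd = zF * xF := by
  rw [otherProd, map_inv₀, onY_xF, tF_inv_eq]

lemma otherSum_mem_polarRing : otherSum ∈ polarRing :=
  sub_mem tF_inv_mem_polarRing xF_mem_polarRing

lemma otherProd_mem_polarRing : otherProd ∈ polarRing := xF_inv_mem_polarRing

lemma toXField_tSeries_C (c : ℂ) : toXField (tSeries (C c)) = algebraMap ℂ XField c := by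
  rw [← coefX_algebraMap, ← coefX_algebraMap_complex,
    IsScalarTower.algebraMap_apply ℂ ℂ⟦X⟧ TField, PowerSeries.algebraMap_apply]
  rfl

/-- An invariant with a simple pole at `x = 0` is a linear polynomial in `curveInv`. This gives both
its value and, up to `x * t ^ (b + 1)`, its numerator. -/
lemma exists_eq_mul_curveInv_sub {φ : XField} (hinv : onX φ = onY φ) {b : ℕ} {F : XSeries} {κ : ℂ}
    (hκ : κ ≠ 0) (hF : xF * tF ^ (b + 1) * φ = toXField F) (h0 : atZero F = X ^ (b + 1) * C κ) :
    ∃ g : ℂ⟦X⟧, F = tSeries (C κ) * X ^ b * (X + xVar ^ 2 - X * xVar ^ 3) + xVar * tSeries g ∧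
      φ = algebraMap ℂ XField κ * (curveInv - coefX (-(algebraMap ℂ⟦X⟧ TField g *
        (algebraMap ℂ TField κ)⁻¹ * (algebraMap ℂ⟦X⟧ TField X ^ (b + 1))⁻¹))) := by
  have ht := tF_ne_zero
  have hx := xF_ne_zero
  have hκ' : algebraMap ℂ XField κ ≠ 0 := by
    rwa [Ne, map_eq_zero_iff _ (algebraMap ℂ XField).injective]
  set η : XSeries := X + xVar ^ 2 - X * xVar ^ 3 with hη
  have hη' : toXField η = xF * tF * curveInv := by
    simp only [hη, map_add, map_sub, map_mul, map_pow, ← xF.eq_def, ← tF.eq_def, curveInv]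
    field_simp
  obtain ⟨G, hG⟩ : ∃ G, F - tSeries (C κ) * X ^ b * η = xVar * G := by
    apply exists_eq_mul_of_atZero
    simp only [map_sub, map_mul, map_pow, h0, atZero_tSeries, atZero_X, hη, map_add, atZero_xVar]
    ring
  have hG' : toXField G = tF ^ (b + 1) * (φ - algebraMap ℂ XField κ * curveInv) := by
    apply mul_left_cancel₀ hx
    have h1 := congrArg toXField hG
    rw [map_sub, map_mul, map_mul, map_mul, map_pow, hη', ← hF, toXField_tSeries_C, ← xF.eq_def,
      ← tF.eq_def] at h1
    rw [← h1]
    ring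
  have h1 : evalAtX G = evalAtY G := by
    apply toXField_injective
    rw [← onX_toXField, ← onY_toXField, hG']
    simp only [map_mul, map_pow, map_sub, onX_tF, onY_tF, hinv, onX_curveInv,
      onX_algebraMap_complex, onY_algebraMap_complex]
  have h2 : G = tSeries (atZero G) := by
    rw [← sub_eq_zero]
    refine eq_zero_of_evalAtX_eq_evalAtY (by simp) ?_
    rw [map_sub, map_sub, h1, evalAtX_tSeries]
  set T : TField := algebraMap ℂ⟦X⟧ TField X with hT
  refine ⟨atZero G, by rw [← h2, ← hG]; ring, ?_⟩
  rw [map_neg, map_mul, map_mul, map_inv₀, map_inv₀, map_pow, coefX_algebraMap_complex, hT, coefX_X,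
    coefX_algebraMap, ← h2, hG']
  field_simp
  ring

/-- The two forms of the functional equation on the kernel curve, with and without exchange of the
coordinates. -/
lemma sector_equations {c : ℕ} (hc : c ≤ 1) (s : ℂ) :
    (xF * tF - kerT * onX (toXField (sectorA c s)) - kerT * onY (toXField (sectorB c s))
      + kerT * onX (toXField (tSeries (sectorPoint c s 0)))
      + kerT * algebraMap ℂ XField s * (xF * tF) * tF ^ c * onY (toXField (sectorA c s))
      + kerT * (algebraMap ℂ XField s)⁻¹ * (xF * tF)
        * onX (toXField (sectorTail c s (1 + c))) = 0) ∧
    (xF * tF - kerT * onY (toXField (sectorA c s)) - kerT * onX (toXField (sectorB c s))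
      + kerT * onX (toXField (tSeries (sectorPoint c s 0)))
      + kerT * algebraMap ℂ XField s * (xF * tF) * xF ^ c * onX (toXField (sectorA c s))
      + kerT * (algebraMap ℂ XField s)⁻¹ * (xF * tF)
        * onY (toXField (sectorTail c s (1 + c))) = 0) := by
  have h1 := congrArg toXField (kernel_equation s hc (a := xVar) (b := X) constantCoeff_kernelT
    kernelT_mul)
  have h2 := congrArg toXField (kernel_equation s hc (a := X) (b := xVar) constantCoeff_kernelT
    (by linear_combination kernelT_mul))
  have e : ∀ c : ℂ, toXField (algebraMap ℂ XSeries c) = algebraMap ℂ XField c := fun c =>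
    (IsScalarTower.algebraMap_apply ℂ XSeries XField c).symm
  simp only [map_add, map_sub, map_mul, map_pow, e, map_zero, ← evalAtX.eq_def, ← evalAtY.eq_def,
    ← onX_toXField, ← onY_toXField, ← xF.eq_def, ← tF.eq_def, ← kerT.eq_def, map_inv₀] at h1 h2
  constructor
  · exact h1
  · rw [onX_toXField (tSeries _), evalAtX_tSeries, ← onY_toXField]
    linear_combination h2

end SimplePole

/-! ### The cell-centred lattice -/

section Cell

open PowerSeries

lemma cell_invariants_mem {K : Type*} [CommRing K] (R : Subring K) {x e₁ e₂ α β : K} (hx : x ∈ R)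
    (h₁ : e₁ ∈ R) (h₂ : e₂ ∈ R) (hα : α ∈ R) (hβ : β ∈ R) :
    x ^ 2 * (α ^ 3 * e₁ + 6 * α ^ 2 * β * e₂ + 3 * α * β ^ 2 * e₁ * e₂
      + β ^ 3 * e₂ * (e₁ ^ 2 - 2 * e₂)) ∈ R ∧
    x * (α ^ 2 + α * β * e₁ + β ^ 2 * e₂) ∈ R ∧
    -(x ^ 2 - x * e₁ + e₂) * x ^ 2 * (e₁ ^ 2 - 4 * e₂)
      * (α ^ 3 - 3 * α * β ^ 2 * e₂ - β ^ 3 * e₁ * e₂) ∈ R := by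
  refine ⟨?_, ?_, ?_⟩ <;>
  apply_rules [mul_mem, add_mem, sub_mem, neg_mem, pow_mem, ofNat_mem]

set_option maxHeartbeats 1000000 in
/-- A derivation that kills `t` kills the generating function of the walks on the cell-centred
lattice. The functions `u = f ^ 3 * x / z` and `v = g ^ 3 * x / y`, where `f = α + z * β` and
`g = α + y * β`, are multiplied by powers of `s` under rotation of the coordinates. -/
theorem derivation_sectorPoint_zero {s : ℂ} (hs : ∃ N : ℕ, 0 < N ∧ s ^ N = 1) (hs3 : s ^ 3 ≠ 1)
    (δ : Derivation ℂ TField TField) (hδ : δ (algebraMap ℂ⟦X⟧ TField X) = 0) :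
    δ (algebraMap ℂ⟦X⟧ TField (sectorPoint 0 s 0)) = 0 := by
  obtain ⟨N₀, hN₀, hsN⟩ := hs
  have hs0 : s ≠ 0 := by
    rintro rfl
    rw [zero_pow hN₀.ne'] at hsN
    exact zero_ne_one hsN
  set E := sectorPoint 0 s 0 with hE
  set Af := sectorA 0 s with hAf
  set Bf := sectorTail 0 s 1 with hBf
  have hA0 : atZero Af = E := atZero_sectorA s (by norm_num)
  have hB : sectorB 0 s = tSeries E + xVar * Bf := by
    rw [← sectorTail_zero, sectorTail_eq s (by norm_num)]
  obtain ⟨h1, h2⟩ := sector_equations (c := 0) (by norm_num) s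
  rw [← hE, ← hAf, hB] at h1 h2
  simp only [add_zero, ← hBf, pow_zero, mul_one, map_add, map_mul, ← xF.eq_def,
    onX_xF, onY_xF] at h1 h2
  have hEE : onX (toXField (tSeries E)) = onY (toXField (tSeries E)) := by
    rw [onX_toXField, onY_toXField, evalAtX_tSeries]
  rw [← hEE] at h1
  have hx := xF_ne_zero
  have hy := tF_ne_zero
  have hxyz := xF_mul_tF_mul_zF
  set σ : XField := algebraMap ℂ XField s with hσ
  have hσ0 : σ ≠ 0 := by rwa [hσ, Ne, map_eq_zero_iff _ (algebraMap ℂ XField).injective]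
  have hσ' : σ * σ⁻¹ = 1 := mul_inv_cancel₀ hσ0
  -- the functions `x * α` and `β`
  set aS : XSeries := tSeries (C ((s ^ 3 - 1) * s⁻¹)) * X * xVar * Bf - xVar - tSeries (C s)
    with haS
  set bS : XSeries := -(tSeries (C (s ^ 3 - 1)) * X * Af + tSeries (C (s ^ 2))) with hbS
  set α : XField := toXField aS * otherProd with hα
  set β : XField := toXField bS with hβ
  have ha : toXField aS = (σ ^ 3 - 1) * σ⁻¹ * tF * xF * toXField Bf - xF - σ := by
    simp only [haS, map_sub, map_mul, toXField_tSeries_C, map_pow, map_one, map_inv₀,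
      ← xF.eq_def, ← tF.eq_def, ← hσ]
  have hb : β = -((σ ^ 3 - 1) * tF * toXField Af + σ ^ 2) := by
    simp only [hβ, hbS, map_neg, map_add, map_mul, map_sub, toXField_tSeries_C, map_pow, map_one,
      ← tF.eq_def, ← hσ]
  have hαm : α ∈ polarRing := mul_mem (toXField_mem_polarRing _) otherProd_mem_polarRing
  have hβm : β ∈ polarRing := toXField_mem_polarRing _
  have hXσ : onX σ = σ := onX_algebraMap_complex s
  have hYσ : onY σ = σ := onY_algebraMap_complex s
  have hαX : onX α = ((σ ^ 3 - 1) * σ⁻¹ * kerT * xF * onX (toXField Bf) - xF - σ)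
      * (tF * zF) := by
    simp only [hα, ha, map_mul, map_sub, map_pow, map_one, map_inv₀, hXσ, onX_tF, onX_xF,
      onX_otherProd]
  have hαY : onY α = ((σ ^ 3 - 1) * σ⁻¹ * kerT * tF * onY (toXField Bf) - tF - σ)
      * (zF * xF) := by
    simp only [hα, ha, map_mul, map_sub, map_pow, map_one, map_inv₀, hYσ, onY_tF, onY_xF,
      onY_otherProd]
  have hβX : onX β = -((σ ^ 3 - 1) * kerT * onX (toXField Af) + σ ^ 2) := by
    simp only [hb, map_neg, map_add, map_mul, map_sub, map_pow, map_one, hXσ, onX_tF]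
  have hβY : onY β = -((σ ^ 3 - 1) * kerT * onY (toXField Af) + σ ^ 2) := by
    simp only [hb, map_neg, map_add, map_mul, map_sub, map_pow, map_one, hYσ, onY_tF]
  have rel1 : xF * (onX α + zF * onX β) = σ * (onY α + xF * onY β) := by
    rw [hαX, hαY, hβX, hβY]
    linear_combination (σ ^ 3 - 1) * zF * xF * h1
      + (-σ ^ 3 * xF - (σ ^ 3 - 1) * σ * kerT * xF * onY (toXField Af)) * hxyz
      - (σ ^ 3 - 1) * kerT * xF * tF * zF * onY (toXField Bf) * hσ'
  have rel2 : tF * (onY α + zF * onY β) = σ * (onX α + tF * onX β) := by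
    rw [hαX, hαY, hβX, hβY]
    linear_combination (σ ^ 3 - 1) * zF * tF * h2
      + (-σ ^ 3 * tF - (σ ^ 3 - 1) * σ * kerT * tF * onX (toXField Af)) * hxyz
      - (σ ^ 3 - 1) * kerT * xF * tF * zF * onX (toXField Bf) * hσ'
  have rel1c := congrArg (· ^ 3) rel1
  have rel2c := congrArg (· ^ 3) rel2
  simp only [mul_pow] at rel1c rel2c
  -- the symmetric functions of `u` and `v`
  set e₁ := otherSum with he₁
  set e₂ := otherProd with he₂
  have h₁m : e₁ ∈ polarRing := otherSum_mem_polarRing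
  have h₂m : e₂ ∈ polarRing := otherProd_mem_polarRing
  have hxm := xF_mem_polarRing
  set M : XField := xF * (α ^ 2 + α * β * e₁ + β ^ 2 * e₂) with hM
  set T : XField := xF ^ 2 * (α ^ 3 * e₁ + 6 * α ^ 2 * β * e₂ + 3 * α * β ^ 2 * e₁ * e₂
    + β ^ 3 * e₂ * (e₁ ^ 2 - 2 * e₂)) with hT
  set Θ : XField := -(xF ^ 2 - xF * e₁ + e₂) * xF ^ 2 * (e₁ ^ 2 - 4 * e₂)
    * (α ^ 3 - 3 * α * β ^ 2 * e₂ - β ^ 3 * e₁ * e₂) with hΘ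
  set u : XField := xF ^ 2 * tF * (onX α + zF * onX β) ^ 3 with hu
  set v : XField := xF ^ 2 * zF * (onX α + tF * onX β) ^ 3 with hv
  set u' : XField := tF ^ 2 * zF * (onY α + xF * onY β) ^ 3 with hu'
  set v' : XField := tF ^ 2 * xF * (onY α + zF * onY β) ^ 3 with hv'
  have hMX : onX M = xF * ((onX α + zF * onX β) * (onX α + tF * onX β)) := by
    simp only [hM, map_mul, map_add, map_pow, onX_xF, he₁, he₂, onX_otherSum, onX_otherProd]
    ring
  have hMY : onY M = tF * ((onY α + xF * onY β) * (onY α + zF * onY β)) := by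
    simp only [hM, map_mul, map_add, map_pow, onY_xF, he₁, he₂, onY_otherSum, onY_otherProd]
    ring
  have hMinv : onX M = onY M := by
    rw [hMX, hMY]
    apply mul_left_cancel₀ hσ0
    linear_combination σ * (onX α + tF * onX β) * rel1 - σ * (onY α + xF * onY β) * rel2
  have huu : u = σ ^ 3 * u' := by
    apply mul_left_cancel₀ hx
    linear_combination tF * rel1c - σ ^ 3 * tF * (onY α + xF * onY β) ^ 3 * hxyz
  have hvv : v' = σ ^ 3 * v := by
    apply mul_left_cancel₀ hy
    linear_combination xF * rel2c - σ ^ 3 * xF * (onX α + tF * onX β) ^ 3 * hxyz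
  have hσN : (σ ^ 3) ^ (2 * N₀) = 1 := by
    rw [hσ, ← map_pow, ← map_pow, ← pow_mul, show 3 * (2 * N₀) = N₀ * 6 by ring, pow_mul, hsN,
      one_pow, map_one]
  -- the polar parts at `x = 0`
  set S : XSeries := X * aS ^ 2 + aS * bS * (xVar - X * xVar ^ 2) + X * xVar * bS ^ 2 with hS
  have hSM : xF * tF ^ (0 + 1) * M = toXField S := by
    simp only [hS, map_add, map_sub, map_mul, map_pow, ← xF.eq_def, ← tF.eq_def, hM, hα, ← hβ, he₁,
      he₂, otherSum, otherProd]
    field_simp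
    ring
  have haS0 : atZero aS = -C s := by simp [haS]
  have hbS0 : atZero bS = -(C (s ^ 3 - 1) * X * E + C (s ^ 2)) := by
    rw [hbS, map_neg, map_add, map_mul, map_mul, hA0, atZero_tSeries, atZero_tSeries, atZero_X]
  have hS0 : atZero S = X ^ (0 + 1) * C (s ^ 2) := by
    simp only [hS, map_add, map_mul, map_pow, map_sub, atZero_X, atZero_xVar, haS0]
    ring
  obtain ⟨r, hr⟩ : ∃ r : TField, M = algebraMap ℂ XField (s ^ 2) * (curveInv - coefX r) := by
    obtain ⟨g, -, hg⟩ := exists_eq_mul_curveInv_sub hMinv (pow_ne_zero 2 hs0) hSM hS0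
    exact ⟨_, hg⟩
  set TS : XSeries := X * aS ^ 3 * (1 - X * xVar) + 6 * X ^ 2 * aS ^ 2 * bS
    + 3 * X * aS * bS ^ 2 * xVar * (1 - X * xVar)
    + bS ^ 3 * (xVar ^ 2 * (1 - X * xVar) ^ 2 - 2 * X ^ 2 * xVar) with hTS
  have hTST : toXField TS = xF * tF ^ 2 * T := by
    simp only [hTS, map_add, map_sub, map_mul, map_pow, map_one, map_ofNat, ← xF.eq_def,
      ← tF.eq_def, hT, hα, ← hβ, he₁, he₂, otherSum, otherProd]
    field_simp
  have hTS0 : atZero TS = X * (-C s) ^ 3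
      - 6 * X ^ 2 * C s ^ 2 * (C (s ^ 3 - 1) * X * E + C (s ^ 2)) := by
    simp only [hTS, map_add, map_sub, map_mul, map_pow, map_one, map_ofNat, atZero_X, atZero_xVar,
      haS0, hbS0]
    ring
  have hcore := proportional_or_derivation_eq_zero (T := T) (N := M ^ 3) (Θ := Θ) (u := u) (v := v)
    (u' := u') (v' := v') (n := 2 * N₀) (h := 3 * N₀) (m := 3) (c := (s ^ 2) ^ 3) (r := r)
    ?_ ?_ ?_ ?_ ?_ ?_ ?_ ?_ ?_ ?_ ?_ ?_ ?_ ?_ ?_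
  · rcases hcore with ⟨ζ, hζ, hprop⟩ | hder
    · -- the pole of odd order of `M ^ 3` at `x = 0` forces `ζ = -1` and `T = 0`, but `T` has a
      -- nonzero polar part
      exfalso
      have e1 : xVar * TS ^ 2 * tSeries (C ζ) = X * tSeries (C ((1 + ζ) ^ 2)) * S ^ 3 := by
        apply toXField_injective
        simp only [map_mul, map_pow, hTST, ← hSM, toXField_tSeries_C, ← xF.eq_def, ← tF.eq_def]
        linear_combination xF ^ 3 * tF ^ 4 * hprop
      have e2 := congrArg atZero e1
      simp only [map_mul, map_pow, atZero_xVar, atZero_X, zero_mul, hS0, atZero_tSeries] at e2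
      have e3 : (C ((1 + ζ) ^ 2) : ℂ⟦X⟧) = 0 := by
        by_contra hne
        refine mul_ne_zero (mul_ne_zero X_ne_zero (by simpa using hne))
          (pow_ne_zero 3 (mul_ne_zero (pow_ne_zero _ X_ne_zero) (pow_ne_zero 2 ?_))) e2.symm
        rwa [Ne, map_eq_zero_iff _ C_injective]
      rw [e3, map_zero, mul_zero, zero_mul] at e1
      have e4 : TS = 0 := by
        have hζ' : tSeries (C ζ) ≠ 0 := by
          rw [Ne, map_eq_zero_iff _ tSeries_injective, map_eq_zero_iff _ C_injective]
          exact hζ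
        exact (pow_eq_zero_iff two_ne_zero).1
          ((mul_eq_zero.1 ((mul_eq_zero.1 e1).resolve_right hζ')).resolve_left xVar_ne_zero)
      have e5 : atZero TS = X * (C (-s ^ 3)
          + X * (-6 * C s ^ 2 * (C (s ^ 3 - 1) * X * E + C (s ^ 2)))) := by
        rw [hTS0]
        simp only [map_neg, map_pow]
        ring
      rw [e4, map_zero] at e5
      have e6 := congrArg (coeff 1) e5
      rw [coeff_succ_X_mul, map_zero, map_add, coeff_zero_X_mul, coeff_zero_C, add_zero] at e6
      exact pow_ne_zero 3 hs0 (neg_eq_zero.1 e6.symm)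
    · obtain ⟨D, hD⟩ := exists_expansionDerivation δ
      have hDT := (hder δ hδ).2 D hD
      have hD0 : D (expandX (toXField TS)) = 0 := by
        rw [hTST, map_mul expandX, map_mul expandX, map_pow expandX, Derivation.leibniz,
          Derivation.leibniz, Derivation.leibniz_pow, hDT, derivation_expandX_xF hD,
          derivation_expandX_tF hD hδ]
        simp
      have h3 := derivation_atZero_eq_zero hD hD0
      have h4 : atZero TS = C (-s ^ 3) * X - C (6 * s ^ 4) * X ^ 2
          - C (6 * s ^ 2 * (s ^ 3 - 1)) * X ^ 3 * E := by
        rw [hTS0]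
        simp only [map_neg, map_pow, map_mul, map_ofNat]
        ring
      have h5 : ∀ c : ℂ, δ (algebraMap ℂ⟦X⟧ TField (C c)) = 0 := δ.map_algebraMap
      rw [h4] at h3
      simp only [map_sub, map_mul (algebraMap ℂ⟦X⟧ TField), map_pow (algebraMap ℂ⟦X⟧ TField),
        Derivation.leibniz, Derivation.leibniz_pow, h5, hδ, smul_eq_mul, smul_zero, mul_zero,
        zero_sub, add_zero, sub_zero, neg_eq_zero] at h3
      refine (mul_eq_zero.1 h3).resolve_left (mul_ne_zero ?_ (pow_ne_zero 3 ?_))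
      · rw [Ne, map_eq_zero_iff _ (IsFractionRing.injective ℂ⟦X⟧ TField),
          map_eq_zero_iff _ C_injective]
        exact mul_ne_zero (mul_ne_zero (by norm_num) (pow_ne_zero 2 hs0)) (sub_ne_zero.2 hs3)
      · rw [Ne, map_eq_zero_iff _ (IsFractionRing.injective ℂ⟦X⟧ TField)]
        exact X_ne_zero
  · exact (cell_invariants_mem polarRing hxm h₁m h₂m hαm hβm).1
  · exact pow_mem (cell_invariants_mem polarRing hxm h₁m h₂m hαm hβm).2.1 3
  · exact (cell_invariants_mem polarRing hxm h₁m h₂m hαm hβm).2.2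
  · simp only [hT, map_mul, map_add, map_sub, map_pow, map_ofNat, onX_xF, he₁, he₂, onX_otherSum,
      onX_otherProd, hu, hv]
    ring
  · rw [map_pow, hMX, hu, hv]
    linear_combination
      (-xF ^ 3 * ((onX α + zF * onX β) * (onX α + tF * onX β)) ^ 3) * hxyz
  · simp only [hΘ, map_mul, map_add, map_sub, map_neg, map_pow, map_ofNat, onX_xF, he₁, he₂,
      onX_otherSum, onX_otherProd, hu, hv, curveDiff]
    ring
  · simp only [hT, map_mul, map_add, map_sub, map_pow, map_ofNat, onY_xF, he₁, he₂, onY_otherSum,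
      onY_otherProd, hu', hv']
    ring
  · rw [map_pow, hMY, hu', hv']
    linear_combination
      (-tF ^ 3 * ((onY α + xF * onY β) * (onY α + zF * onY β)) ^ 3) * hxyz
  · simp only [hΘ, map_mul, map_add, map_sub, map_neg, map_pow, map_ofNat, onY_xF, he₁, he₂,
      onY_otherSum, onY_otherProd, hu', hv', curveDiff]
    ring
  · rw [huu, mul_pow (σ ^ 3) u', hσN, one_mul]
  · rw [hvv, mul_pow (σ ^ 3) v, hσN, one_mul]
  · omega
  · omega
  · exact pow_ne_zero _ (pow_ne_zero _ hs0)
  · rw [hr, mul_pow, ← map_pow]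

end Cell

/-! ### The vertex-centred lattice -/

section Vertex

open PowerSeries

/-- The branch `x = p ^ 2` of the discriminant `x * (1 - t * x) ^ 2 = 4 * t ^ 2` of the kernel is
parametrised by the solution of `p = t * (2 + p ^ 3)`. -/
lemma exists_eq_X_mul_two_add_cube : ∃ p : ℂ⟦X⟧, p = X * (2 + p ^ 3) := by
  -- `X / p` is a simple root of a monic polynomial, to which Hensel's lemma applies
  set f : Polynomial ℂ⟦X⟧ := Polynomial.X ^ 3 - Polynomial.C (C (1 / 2)) * Polynomial.X ^ 2
    + Polynomial.C (C (1 / 2) * X ^ 3) with hf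
  have hmonic : f.Monic := by
    rw [hf, sub_add]
    refine Polynomial.monic_X_pow_sub (n := 3) ?_
    refine (Polynomial.degree_sub_le (R := ℂ⟦X⟧) _ _).trans_lt (max_lt ?_ ?_)
    · exact (Polynomial.degree_C_mul_X_pow_le 2 _).trans_lt (by norm_num)
    · exact Polynomial.degree_C_le.trans_lt (by norm_num)
  have hderiv : (f.derivative).eval (C (1 / 2)) = C (1 / 4) := by
    simp only [hf, Polynomial.derivative_add, Polynomial.derivative_sub,
      Polynomial.derivative_X_pow, Polynomial.derivative_C_mul, Polynomial.derivative_C,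
      Polynomial.eval_sub,
      Polynomial.eval_mul, Polynomial.eval_C, Polynomial.eval_pow, Polynomial.eval_X, ← map_pow,
      add_zero, Nat.cast_ofNat]
    have h3 : (3 : ℂ⟦X⟧) = C 3 := (map_ofNat C 3).symm
    have h2 : (2 : ℂ⟦X⟧) = C 2 := (map_ofNat C 2).symm
    rw [h3, h2, ← map_mul, ← map_mul, ← map_mul, ← map_sub]
    norm_num
  have heval : f.eval (C (1 / 2)) ∈ Ideal.span {(X : ℂ⟦X⟧)} := by
    rw [Ideal.mem_span_singleton, X_dvd_iff]
    simp [hf]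
    norm_num
  obtain ⟨v, hv, hv0⟩ := HenselianRing.is_henselian (I := Ideal.span {(X : ℂ⟦X⟧)}) f hmonic
    (C (1 / 2)) heval (by
      rw [hderiv]
      exact ((IsUnit.mk0 (1 / 4 : ℂ) (by norm_num)).map C).map _)
  rw [Ideal.mem_span_singleton, X_dvd_iff, map_sub, constantCoeff_C, sub_eq_zero] at hv0
  have hinv : v * v⁻¹ = 1 := PowerSeries.mul_inv_cancel _ (by rw [hv0]; norm_num)
  have hroot : 2 * v ^ 3 = v ^ 2 - X ^ 3 := by
    have h2 : (2 : ℂ⟦X⟧) * C (1 / 2) = 1 := by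
      rw [← map_ofNat (C (R := ℂ)) 2, ← map_mul, ← map_one (C (R := ℂ))]
      norm_num
    have h1 : f.eval v = 0 := hv
    simp only [hf, Polynomial.eval_add, Polynomial.eval_sub, Polynomial.eval_mul, Polynomial.eval_C,
      Polynomial.eval_pow, Polynomial.eval_X] at h1
    linear_combination 2 * h1 + (v ^ 2 - X ^ 3) * h2
  refine ⟨X * v⁻¹, ?_⟩
  linear_combination -X * (v⁻¹ ^ 3 * hroot)
    + X * (- v⁻¹ * (v * v⁻¹ + 1) + 2 * ((v * v⁻¹) ^ 2 + v * v⁻¹ + 1)) * hinv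

lemma substSeries_tSeries {a : ℂ⟦X⟧} (g : ℂ⟦X⟧) :
    substSeries a X constantCoeff_X (tSeries g) = g := by
  ext m
  rw [tSeries, substSeries, RingHom.comp_apply, coeff_evalSeries _ _ (Nat.lt_succ_self m), map_sum,
    Finset.sum_eq_single m]
  · simp [coeff_mul_X_pow']
  · intro n _ hn
    simp only [coeff_map, RingHom.coe_coe, Polynomial.aeval_C, PowerSeries.algebraMap_apply,
      coeff_mul_X_pow', coeff_C]
    split_ifs with h1 h2
    · omega
    · rfl
    · rfl
  · simp

/-- A derivation that kills `t` kills the function `g` if the numerator of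
`κ * curveInv + g / t ^ 2` vanishes on a branch of the discriminant. -/
lemma derivation_eq_zero_of_discriminant {S β : XSeries} {κ : ℂ} {g : ℂ⟦X⟧}
    (hS : S = tSeries (C κ) * X * (X + xVar ^ 2 - X * xVar ^ 3) + xVar * tSeries g)
    (hdisc : 4 * S = -β ^ 2 * (xVar * (1 - X * xVar) ^ 2 - 4 * X ^ 2))
    (δ : Derivation ℂ TField TField) (hδ : δ (algebraMap ℂ⟦X⟧ TField X) = 0) :
    δ (algebraMap ℂ⟦X⟧ TField g) = 0 := by
  obtain ⟨p, hp⟩ := exists_eq_X_mul_two_add_cube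
  have : CharZero ℂ⟦X⟧ := charZero_of_injective_algebraMap (algebraMap ℂ ℂ⟦X⟧).injective
  set φ := algebraMap ℂ⟦X⟧ TField with hφ
  have hφinj : Function.Injective φ := IsFractionRing.injective ℂ⟦X⟧ TField
  set ψ := substSeries (p ^ 2) (X : ℂ⟦X⟧) constantCoeff_X with hψ
  have hψX : ψ X = X := substSeries_X _
  have hψx : ψ xVar = p ^ 2 := by rw [hψ, xVar, substSeries_C, Polynomial.aeval_X]
  have hψg : ∀ g, ψ (tSeries g) = g := fun g => substSeries_tSeries g
  have h1 : ψ S = 0 := by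
    have h2 := congrArg ψ hdisc
    simp only [map_mul, map_sub, map_pow, map_neg, map_one, map_ofNat, hψX, hψx] at h2
    have h3 : p ^ 2 * (1 - X * p ^ 2) ^ 2 - 4 * X ^ 2 = 0 := by
      linear_combination (p - X * p ^ 3 + 2 * X) * hp
    rw [h3, mul_zero] at h2
    exact (mul_eq_zero.1 h2).resolve_left (OfNat.ofNat_ne_zero 4)
  rw [hS] at h1
  simp only [map_mul, map_sub, map_pow, map_add, hψX, hψx, hψg] at h1
  have hp0 : p ≠ 0 := by
    rintro rfl
    rw [zero_pow three_ne_zero, add_zero] at hp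
    exact mul_ne_zero X_ne_zero two_ne_zero hp.symm
  have hδp : δ (φ p) = 0 := by
    have h2 : δ (φ (p - X * p ^ 3)) = 0 := by
      rw [show p - X * p ^ 3 = 2 * X by linear_combination hp, map_mul φ, map_ofNat,
        Derivation.leibniz, hδ, ← map_ofNat (algebraMap ℂ TField) 2, δ.map_algebraMap]
      simp
    have h3 : φ (1 - 3 * X * p ^ 2) * δ (φ p) = 0 := by
      simp only [map_sub, map_mul φ, map_pow φ, Derivation.leibniz, Derivation.leibniz_pow, hδ,
        smul_eq_mul, nsmul_eq_mul, mul_zero, add_zero] at h2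
      simp only [map_sub, map_mul φ, map_pow φ, map_one, map_ofNat]
      linear_combination h2
    refine (mul_eq_zero.1 h3).resolve_left ?_
    rw [map_eq_zero_iff _ hφinj]
    intro h4
    have h5 := congrArg constantCoeff h4
    simp at h5
  have h2 : δ (φ (C κ * X * (X + (p ^ 2) ^ 2 - X * (p ^ 2) ^ 3))) = 0 := by
    have h5 : ∀ c : ℂ, δ (φ (C c)) = 0 := δ.map_algebraMap
    simp only [map_sub, map_add, map_mul φ, map_pow φ, Derivation.leibniz, Derivation.leibniz_pow,
      hδ, hδp, h5, smul_zero, add_zero, sub_zero]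
  rw [eq_neg_of_add_eq_zero_left h1] at h2
  simp only [map_neg, map_mul φ, map_pow φ, Derivation.leibniz, Derivation.leibniz_pow, hδp,
    smul_zero, mul_zero, add_zero, neg_eq_zero, smul_eq_mul] at h2
  refine (mul_eq_zero.1 h2).resolve_left (pow_ne_zero 2 ?_)
  rwa [Ne, map_eq_zero_iff _ hφinj]

lemma vertex_invariants_mem {K : Type*} [CommRing K] (R : Subring K) {x e₁ e₂ α β : K} (hx : x ∈ R)
    (h₁ : e₁ ∈ R) (h₂ : e₂ ∈ R) (hα : α ∈ R) (hβ : β ∈ R) :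
    2 * α + β * e₁ ∈ R ∧ α ^ 2 + α * β * e₁ + β ^ 2 * e₂ ∈ R ∧
    (x ^ 2 - x * e₁ + e₂) * (e₁ ^ 2 - 4 * e₂) * β ∈ R := by
  refine ⟨?_, ?_, ?_⟩ <;>
  apply_rules [mul_mem, add_mem, sub_mem, neg_mem, pow_mem, ofNat_mem]

set_option maxHeartbeats 1000000 in
/-- A derivation that kills `t` kills the generating function of the walks on the vertex-centred
lattice. The functions `u = α + z * β` and `v = α + y * β` are multiplied by powers of `s` under
rotation of the coordinates. -/
theorem derivation_sectorPoint_one {s : ℂ} (hs : ∃ N : ℕ, 0 < N ∧ s ^ N = 1) (hs3 : s ^ 3 ≠ 1)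
    (δ : Derivation ℂ TField TField) (hδ : δ (algebraMap ℂ⟦X⟧ TField X) = 0) :
    δ (algebraMap ℂ⟦X⟧ TField (sectorPoint 1 s 0)) = 0 := by
  obtain ⟨N₀, hN₀, hsN⟩ := hs
  have hs0 : s ≠ 0 := by
    rintro rfl
    rw [zero_pow hN₀.ne'] at hsN
    exact zero_ne_one hsN
  have hs1 : s - s ^ 2 ≠ 0 := by
    intro h
    have h1 : s * (1 - s) = 0 := by linear_combination h
    have h2 : s = 1 := (sub_eq_zero.1 ((mul_eq_zero.1 h1).resolve_left hs0)).symm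
    exact hs3 (by rw [h2, one_pow])
  set E := sectorPoint 1 s 0 with hE
  set E₁ := sectorPoint 1 s 1 with hE₁
  set Af := sectorA 1 s with hAf
  set Bf := sectorTail 1 s 2 with hBf
  have hA0 : atZero Af = E := atZero_sectorA s le_rfl
  have hB : sectorB 1 s = tSeries E + xVar * (tSeries E₁ + xVar * Bf) := by
    rw [← sectorTail_zero, sectorTail_eq s le_rfl, sectorTail_eq s le_rfl]
  obtain ⟨h1, h2⟩ := sector_equations (c := 1) le_rfl s
  rw [← hE, ← hAf, hB] at h1 h2
  simp only [one_add_one_eq_two, ← hBf, pow_one, map_add, map_mul, ← xF.eq_def, onX_xF, onY_xF]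
    at h1 h2
  have hEE : ∀ q, onY (toXField (tSeries q)) = onX (toXField (tSeries q)) := fun q => by
    rw [onX_toXField, onY_toXField, evalAtX_tSeries]
  simp only [hEE] at h1 h2
  set ε := onX (toXField (tSeries E₁)) with hε
  have hx := xF_ne_zero
  have hy := tF_ne_zero
  have hxyz := xF_mul_tF_mul_zF
  set σ : XField := algebraMap ℂ XField s with hσ
  have hσ0 : σ ≠ 0 := by rwa [hσ, Ne, map_eq_zero_iff _ (algebraMap ℂ XField).injective]
  have hσ' : σ * σ⁻¹ = 1 := mul_inv_cancel₀ hσ0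
  -- the functions `t * α` and `β`
  set aS : XSeries := X * (tSeries (C ((s ^ 3 - 1) * s⁻¹)) * X * xVar * Bf - xVar
      + tSeries (C (1 + s + s ^ 2)) * X * tSeries E₁) - tSeries (C s) * (1 - X * xVar) with haS
  set bS : XSeries := -(tSeries (C (s ^ 3 - 1)) * X * xVar * Af) + tSeries (C (s - s ^ 2)) with hbS
  set α : XField := toXField aS * tF⁻¹ with hα
  set β : XField := toXField bS with hβ
  have ha : α = (σ ^ 3 - 1) * σ⁻¹ * tF * xF * toXField Bf - xF - σ * otherSum
      + (1 + σ + σ ^ 2) * tF * toXField (tSeries E₁) := by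
    simp only [hα, haS, map_sub, map_add, map_mul, toXField_tSeries_C, map_pow, map_one, map_inv₀,
      ← xF.eq_def, ← tF.eq_def, ← hσ, otherSum]
    field_simp
    ring
  have hb : β = -((σ ^ 3 - 1) * tF * xF * toXField Af) + (σ - σ ^ 2) := by
    simp only [hβ, hbS, map_neg, map_add, map_mul, map_sub, toXField_tSeries_C, map_pow, map_one,
      ← xF.eq_def, ← tF.eq_def, ← hσ]
  have hαm : α ∈ polarRing := mul_mem (toXField_mem_polarRing _) tF_inv_mem_polarRing
  have hβm : β ∈ polarRing := toXField_mem_polarRing _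
  have hXσ : onX σ = σ := onX_algebraMap_complex s
  have hYσ : onY σ = σ := onY_algebraMap_complex s
  have hαX : onX α = (σ ^ 3 - 1) * σ⁻¹ * kerT * xF * onX (toXField Bf) - xF - σ * (tF + zF)
      + (1 + σ + σ ^ 2) * kerT * ε := by
    simp only [ha, map_mul, map_add, map_sub, map_pow, map_one, map_inv₀, hXσ, onX_tF, onX_xF,
      onX_otherSum, hε]
  have hαY : onY α = (σ ^ 3 - 1) * σ⁻¹ * kerT * tF * onY (toXField Bf) - tF - σ * (zF + xF)
      + (1 + σ + σ ^ 2) * kerT * ε := by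
    simp only [ha, map_mul, map_add, map_sub, map_pow, map_one, map_inv₀, hYσ, onY_tF, onY_xF,
      onY_otherSum, hε, hEE]
  have hβX : onX β = -((σ ^ 3 - 1) * kerT * xF * onX (toXField Af)) + (σ - σ ^ 2) := by
    simp only [hb, map_neg, map_add, map_mul, map_sub, map_pow, map_one, hXσ, onX_tF, onX_xF]
  have hβY : onY β = -((σ ^ 3 - 1) * kerT * tF * onY (toXField Af)) + (σ - σ ^ 2) := by
    simp only [hb, map_neg, map_add, map_mul, map_sub, map_pow, map_one, hYσ, onY_tF, onY_xF]
  have rel1 : onX α + zF * onX β = σ * (onY α + xF * onY β) := by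
    rw [hαX, hαY, hβX, hβY]
    linear_combination (σ ^ 3 - 1) * zF * xF * h1
      + (σ ^ 3 - 1) * (-xF + kerT * ε + kerT * tF * onY (toXField Bf)
        - kerT * σ * xF * tF * onY (toXField Af) - kerT * σ⁻¹ * xF * onX (toXField Bf)) * hxyz
      - (σ ^ 3 - 1) * kerT * tF * onY (toXField Bf) * hσ'
  have rel2 : onY α + zF * onY β = σ * (onX α + tF * onX β) := by
    rw [hαX, hαY, hβX, hβY]
    linear_combination (σ ^ 3 - 1) * zF * tF * h2
      + (σ ^ 3 - 1) * (-tF + kerT * ε + kerT * xF * onX (toXField Bf)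
        - kerT * σ * xF * tF * onX (toXField Af) - kerT * σ⁻¹ * tF * onY (toXField Bf)) * hxyz
      - (σ ^ 3 - 1) * kerT * xF * onX (toXField Bf) * hσ'
  -- the symmetric functions of `u` and `v`
  set e₁ := otherSum with he₁
  set e₂ := otherProd with he₂
  have h₁m : e₁ ∈ polarRing := otherSum_mem_polarRing
  have h₂m : e₂ ∈ polarRing := otherProd_mem_polarRing
  have hxm := xF_mem_polarRing
  set N : XField := α ^ 2 + α * β * e₁ + β ^ 2 * e₂ with hN
  set T : XField := 2 * α + β * e₁ with hT
  set Θ : XField := (xF ^ 2 - xF * e₁ + e₂) * (e₁ ^ 2 - 4 * e₂) * β with hΘ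
  set u : XField := onX α + zF * onX β with hu
  set v : XField := onX α + tF * onX β with hv
  set u' : XField := onY α + xF * onY β with hu'
  set v' : XField := onY α + zF * onY β with hv'
  have hNX : onX N = u * v := by
    simp only [hN, map_mul, map_add, map_pow, he₁, he₂, onX_otherSum, onX_otherProd, hu, hv]
    ring
  have hNY : onY N = u' * v' := by
    simp only [hN, map_mul, map_add, map_pow, he₁, he₂, onY_otherSum, onY_otherProd, hu', hv']
    ring
  have hNinv : onX N = onY N := by
    rw [hNX, hNY]
    linear_combination v * rel1 - u' * rel2
  have hσN : σ ^ (2 * N₀) = 1 := by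
    rw [hσ, ← map_pow, mul_comm, pow_mul, hsN, one_pow, map_one]
  -- the polar parts at `x = 0`
  set S : XSeries := xVar * aS ^ 2 + xVar * (1 - X * xVar) * aS * bS + X ^ 2 * bS ^ 2 with hS
  have hSN : xF * tF ^ (1 + 1) * N = toXField S := by
    simp only [hS, map_add, map_sub, map_mul, map_pow, map_one, ← xF.eq_def, ← tF.eq_def, hN, hα,
      ← hβ, he₁, he₂, otherSum, otherProd]
    field_simp
  have hbS0 : atZero bS = C (s - s ^ 2) := by
    simp only [hbS, map_add, map_neg, map_mul, atZero_xVar, atZero_tSeries, mul_zero, zero_mul,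
      neg_zero, zero_add]
  have hS0 : atZero S = X ^ (1 + 1) * C ((s - s ^ 2) ^ 2) := by
    simp only [hS, map_add, map_mul, map_pow, map_sub, map_one, atZero_X, atZero_xVar, hbS0]
    ring
  have hκ := pow_ne_zero 2 hs1
  obtain ⟨g, hSg, hNr⟩ := exists_eq_mul_curveInv_sub hNinv hκ hSN hS0
  rw [pow_one] at hSg
  set r : TField := -(algebraMap ℂ⟦X⟧ TField g * (algebraMap ℂ TField ((s - s ^ 2) ^ 2))⁻¹
    * (algebraMap ℂ⟦X⟧ TField X ^ (1 + 1))⁻¹) with hr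
  set TS : XSeries := 2 * aS + bS * (1 - X * xVar) with hTS
  have hTST : toXField TS = tF * T := by
    simp only [hTS, map_add, map_sub, map_mul, map_one, map_ofNat, ← xF.eq_def,
      ← tF.eq_def, hT, hα, ← hβ, he₁, otherSum]
    field_simp
  have hdisc : T ^ 2 - 4 * N = β ^ 2 * (e₁ ^ 2 - 4 * e₂) := by
    rw [hT, hN]
    ring
  have hΔS : toXField (xVar * (1 - X * xVar) ^ 2 - 4 * X ^ 2)
      = xF * tF ^ 2 * (e₁ ^ 2 - 4 * e₂) := by
    simp only [map_sub, map_mul, map_pow, map_one, map_ofNat, ← xF.eq_def, ← tF.eq_def, he₁, he₂,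
      otherSum, otherProd]
    field_simp
  have hcore := proportional_or_derivation_eq_zero (T := T) (N := N) (Θ := Θ) (u := u) (v := v)
    (u' := u') (v' := v') (n := 2 * N₀) (h := N₀) (m := 1) (c := (s - s ^ 2) ^ 2) (r := r)
    ?_ ?_ ?_ ?_ ?_ ?_ ?_ ?_ ?_ ?_ ?_ ?_ ?_ ?_ ?_
  · obtain ⟨D, hD⟩ := exists_expansionDerivation δ
    have hDx := derivation_expandX_xF hD
    have hDt := derivation_expandX_tF hD hδ
    have h5 : ∀ c : ℂ, D (expandX (algebraMap ℂ XField c)) = 0 := fun c => by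
      rw [← coefX_algebraMap_complex]
      exact derivation_expandX_coefX hD (δ.map_algebraMap c)
    -- both alternatives of the dichotomy lead to the same conclusion
    have hrT : δ r = 0 ∧ D (expandX T) = 0 := by
      rcases hcore with ⟨ζ, hζ, hprop⟩ | hder
      · -- the simple pole of `N` at `x = 0` forces `ζ = -1` and `T = 0`
        have e1 : xVar * TS ^ 2 * tSeries (C ζ) = tSeries (C ((1 + ζ) ^ 2)) * S := by
          apply toXField_injective
          simp only [map_mul, map_pow, hTST, ← hSN, toXField_tSeries_C, ← xF.eq_def]
          linear_combination xF * tF ^ 2 * hprop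
        have e2 := congrArg atZero e1
        simp only [map_mul, map_pow, atZero_xVar, zero_mul, hS0, atZero_tSeries] at e2
        have e3 : (C ((1 + ζ) ^ 2) : ℂ⟦X⟧) = 0 := by
          by_contra hne
          refine mul_ne_zero (by simpa using hne) (mul_ne_zero (pow_ne_zero _ X_ne_zero)
            (pow_ne_zero 2 ?_)) e2.symm
          rwa [Ne, map_eq_zero_iff _ C_injective]
        rw [e3, map_zero, zero_mul] at e1
        have e4 : TS = 0 := by
          have hζ' : tSeries (C ζ) ≠ 0 := by
            rw [Ne, map_eq_zero_iff _ tSeries_injective, map_eq_zero_iff _ C_injective]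
            exact hζ
          exact (pow_eq_zero_iff two_ne_zero).1
            ((mul_eq_zero.1 ((mul_eq_zero.1 e1).resolve_right hζ')).resolve_left xVar_ne_zero)
        have hT0 : T = 0 := by
          rw [e4, map_zero] at hTST
          exact (mul_eq_zero.1 hTST.symm).resolve_left hy
        refine ⟨?_, by rw [hT0, map_zero, map_zero]⟩
        have hg : δ (algebraMap ℂ⟦X⟧ TField g) = 0 := by
          refine derivation_eq_zero_of_discriminant hSg (β := bS) ?_ δ hδ
          apply toXField_injective
          rw [map_mul, map_mul, hΔS, ← hSN, map_neg, map_pow, ← hβ, map_ofNat]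
          rw [hT0] at hdisc
          linear_combination (-(xF * tF ^ 2)) * hdisc
        simp only [hr, map_neg, Derivation.leibniz, Derivation.leibniz_inv, Derivation.leibniz_pow,
          hg, hδ, Derivation.map_algebraMap, smul_zero, add_zero, neg_zero]
      · exact ⟨(hder δ hδ).1, (hder δ hδ).2 D hD⟩
    obtain ⟨hr0, hDT⟩ := hrT
    have hDN : D (expandX N) = 0 := by
      rw [hNr, map_mul expandX, map_sub expandX, Derivation.leibniz, map_sub D,
        derivation_expandX_curveInv hD hδ,
        derivation_expandX_coefX hD hr0, h5]
      simp
    have hDe : D (expandX (e₁ ^ 2 - 4 * e₂)) = 0 := by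
      have h4 : D (4 : ExpansionField) = 0 := by
        rw [← map_ofNat (algebraMap ℂ ExpansionField) 4]
        exact D.map_algebraMap _
      simp only [he₁, he₂, otherSum, otherProd, map_sub, map_mul expandX, map_pow expandX, map_inv₀,
        map_ofNat, Derivation.leibniz, Derivation.leibniz_pow, Derivation.leibniz_inv, hDx, hDt, h4,
        smul_zero, add_zero, sub_zero]
    have he0 : e₁ ^ 2 - 4 * e₂ ≠ 0 := by
      intro h0
      rw [h0, mul_zero, map_eq_zero_iff _ toXField_injective] at hΔS
      have h3 := congrArg atZero hΔS
      simp only [map_sub, map_mul, map_pow, map_one, map_ofNat, atZero_X, atZero_xVar, zero_mul,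
        zero_sub, map_zero, neg_eq_zero] at h3
      have : CharZero ℂ⟦X⟧ := charZero_of_injective_algebraMap (algebraMap ℂ ℂ⟦X⟧).injective
      exact mul_ne_zero (OfNat.ofNat_ne_zero 4) (pow_ne_zero 2 X_ne_zero) h3
    have hβ0 : β ≠ 0 := by
      intro h0
      rw [hβ, map_eq_zero_iff _ toXField_injective] at h0
      rw [h0, map_zero, eq_comm, map_eq_zero_iff _ C_injective] at hbS0
      exact hs1 hbS0
    have hDβ : D (expandX β) = 0 := by
      have h3 := congrArg (fun q => D (expandX q)) hdisc
      have h4 : D (4 : ExpansionField) = 0 := by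
        rw [← map_ofNat (algebraMap ℂ ExpansionField) 4]
        exact D.map_algebraMap _
      simp only [map_sub expandX (T ^ 2), map_sub D, map_mul expandX, map_pow expandX, map_ofNat,
        Derivation.leibniz, Derivation.leibniz_pow, hDT, hDN, h4, hDe, smul_eq_mul,
        nsmul_eq_mul, mul_zero, add_zero, zero_add, sub_zero, pow_one, Nat.add_one_sub_one] at h3
      have h6 : expandX (e₁ ^ 2 - 4 * e₂) ≠ 0 := by rwa [Ne, map_eq_zero_iff _ expandX.injective]
      have h7 : expandX β ≠ 0 := by rwa [Ne, map_eq_zero_iff _ expandX.injective]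
      have h8 := (mul_eq_zero.1 h3.symm).resolve_left h6
      have h9 : ((2 : ℕ) : ExpansionField) ≠ 0 := by
        rw [← map_natCast (algebraMap ℂ ExpansionField), Ne,
          map_eq_zero_iff _ (algebraMap ℂ ExpansionField).injective]
        norm_num
      exact (mul_eq_zero.1 ((mul_eq_zero.1 h8).resolve_left h9)).resolve_left h7
    have hDA : D (expandX (toXField Af)) = 0 := by
      have h3 : (σ ^ 3 - 1) * tF * xF * toXField Af = algebraMap ℂ XField (s - s ^ 2) - β := by
        rw [hb, map_sub, map_pow]
        ring
      have h4 : σ ^ 3 - 1 = algebraMap ℂ XField (s ^ 3 - 1) := by rw [map_sub, map_pow, map_one]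
      have h6 := congrArg (fun q => D (expandX q)) h3
      simp only [h4, map_sub expandX (algebraMap ℂ XField _), map_sub D, h5, hDβ, map_mul expandX,
        Derivation.leibniz, hDx, hDt, smul_eq_mul, mul_zero, add_zero, sub_zero] at h6
      refine (mul_eq_zero.1 h6).resolve_left ?_
      simp only [← map_mul expandX]
      rw [map_eq_zero_iff _ expandX.injective, ← h4]
      refine mul_ne_zero (mul_ne_zero ?_ hy) hx
      rw [h4, Ne, map_eq_zero_iff _ (algebraMap ℂ XField).injective]
      exact sub_ne_zero.2 hs3
    rw [← hA0]
    exact derivation_atZero_eq_zero hD hDA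
  · exact (vertex_invariants_mem polarRing hxm h₁m h₂m hαm hβm).1
  · exact (vertex_invariants_mem polarRing hxm h₁m h₂m hαm hβm).2.1
  · exact (vertex_invariants_mem polarRing hxm h₁m h₂m hαm hβm).2.2
  · simp only [hT, map_mul, map_add, map_ofNat, he₁, onX_otherSum, hu, hv]
    ring
  · exact hNX
  · simp only [hΘ, map_mul, map_add, map_sub, map_pow, map_ofNat, onX_xF, he₁, he₂,
      onX_otherSum, onX_otherProd, hu, hv, curveDiff]
    ring
  · simp only [hT, map_mul, map_add, map_ofNat, he₁, onY_otherSum, hu', hv']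
    ring
  · exact hNY
  · simp only [hΘ, map_mul, map_add, map_sub, map_pow, map_ofNat, onY_xF, he₁, he₂,
      onY_otherSum, onY_otherProd, hu', hv', curveDiff]
    ring
  · rw [rel1, mul_pow σ u', hσN, one_mul]
  · rw [rel2, mul_pow σ v, hσN, one_mul]
  · omega
  · omega
  · exact hκ
  · rw [pow_one]
    exact hNr

end Vertex

theorem corollary3 (s : ℂ) (hs : ∃ N : ℕ, 0 < N ∧ s ^ N = 1) (hs3 : s ^ 3 ≠ 1) :
    IsAlgebraic (Polynomial ℂ) (cellSeries s) ∧
      IsAlgebraic (Polynomial ℂ) (vertexSeries s) := by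
  have hs0 : s ≠ 0 := by
    obtain ⟨N, hN, h⟩ := hs
    rintro rfl
    rw [zero_pow hN.ne'] at h
    exact zero_ne_one h
  rw [cellSeries_eq hs0, vertexSeries_eq hs0]
  exact ⟨isAlgebraic_of_derivation (derivation_sectorPoint_zero hs hs3),
    isAlgebraic_of_derivation (derivation_sectorPoint_one hs hs3)⟩
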